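/- Let $W,V:\mathbb{R}\to\mathbb{R}$ be strictly increasing, $W$ càdlàg and $V$ càglàd, with $W(x+1)-W(x)=W(1)-W(0)$ and $V(x+1)-V(x)=V(1)-V(0)$ for all $x$, and $W(0-)=W(0)=0$, $V(0-)=V(0)=0$. Identify $\mathbb{T}=\mathbb{R}/\mathbb{Z}$ with $[0,1)$, functions on $\mathbb T$ with $1$-periodic functions, and let $dW,dV$ be the measures on $\mathbb{T}$ induced by $W,V$ (they may have atoms). Put $D_W^-f(x)=\lim_{y\to x^-}\frac{f(y)-f(x)}{W(y)-W(x)}$ and $D_V^+g(x)=\lim_{y\to x^+}\frac{g(y)-g(x)}{V(y)-V(x)}$. Let $\mathfrak D_{W,V}(\mathbb{T})$ be the set of càdlàg $f:\mathbb{T}\to\mathbb{R}$ such that $D_W^-f$ exists everywhere and is càglàd, and $D_V^+D_W^-f$ exists everywhere and is càdlàg; for such $f$ put $\|f\|_{1,2}^2=\langle (I-D_V^+D_W^-)f,f\rangle_{L^2_V(\mathbb T)}$. Let $H_{W,V}(\mathbb{T})$ be the set of $f\in L^2_V(\mathbb{T})$ that are $L^2_V$-limits of a $\|\cdot\|_{1,2}$-Cauchy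 sequence in $\mathfrak D_{W,V}(\mathbb{T})$. Each $f\in H_{W,V}(\mathbb{T})$ can be written $V$-a.e. as $f(x)=c+\int_{(0,x]}F\,dW$ with a unique constant $c$ and a unique $F\in L^2_W(\mathbb{T})$ satisfying $\int_{\mathbb{T}}F\,dW=0$; write $D_W^-f:=F$ and $f(0):=c$. Let $H_{W,V,\mathcal D}(\mathbb{T})=\{f\in H_{W,V}(\mathbb{T}): f(0)=0\}$ with norm $\|D_W^-f\|_{L^2_W(\mathbb{T})}$, and let $H^{-1}_{W,V,\mathcal D}(\mathbb{T})$ be its dual. Let $B_W$ be a $W$-Brownian motion on $[0,1]$ defined on a probability space: $B_W(0)=0$ a.s.; for $0\le s<t\le 1$ the increment $B_W(t)-B_W(s)$ is independent of $\sigma(B_W(r):0\le r\le s)$ and has law $N(0,W(t)-W(s))$; and the sample paths are a.s. càdlàg on $[0,1]$. For $g\in H_{W,V,\mathcal D}(\mathbb{T})$ put pathwise $$\dot B_W(g)=-\int_{\mathbb{T}}B_W(s-)\,D_W^-g(s)\,dW(s).$$ Let $\kappa,H:\mathbb{T}\to\mathbb{R}$ be measurable and bounded, with $|\kappa|\ge\kappa_0$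 and $H\ge H_0$ for some constants $\kappa_0,H_0>0$. Then there is a real-valued stochastic process $u=(u(x))_{x\in\mathbb T}$ on the same probability space such that almost surely the following hold: the integrals defining $\dot B_W$ converge absolutely and $\dot B_W\in H^{-1}_{W,V,\mathcal D}(\mathbb{T})$; the sample path of $u$ is a càdlàg function on $\mathbb{T}$ with $u(0)=0$; and this path is the unique weak solution (up to $V$-a.e. equality) in $H_{W,V,\mathcal D}(\mathbb{T})$ of $$\kappa^2u-D_V^+(H\,D_W^-u)=\dot B_W,$$ that is, the unique $u\in H_{W,V,\mathcal D}(\mathbb{T})$ with $$\int_{\mathbb{T}}\kappa^2u\,g\,dV+\int_{\mathbb{T}}H\,D_W^-u\,D_W^-g\,dW=\dot B_W(g)\qquad\text{for all } g\in H_{W,V,\mathcal D}(\mathbb{T}).$$ -/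

import Mathlib

open MeasureTheory ProbabilityTheory Filter Topology Set

noncomputable section

namespace WVSobolev

/-! Functions on the torus `𝕋 = ℝ / ℤ` are represented by `1`-periodic functions on `ℝ`, and `𝕋` is
identified with `[0, 1)` whenever one integrates over it. -/

/-- `f` is càdlàg on `S`: right-continuous with left limits (relative to `S`). -/
def IsCadlagOn (f : ℝ → ℝ) (S : Set ℝ) : Prop :=
  ∀ x ∈ S, ContinuousWithinAt f (S ∩ Ici x) x ∧ ∃ l : ℝ, Tendsto f (𝓝[S ∩ Iio x] x) (𝓝 l)

/-- `f` is càdlàg on the whole real line. -/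
def IsCadlag (f : ℝ → ℝ) : Prop :=
  ∀ x, ContinuousWithinAt f (Ici x) x ∧ ∃ l : ℝ, Tendsto f (𝓝[<] x) (𝓝 l)

/-- `f` is càglàd on the whole real line: left-continuous with right limits. -/
def IsCaglad (f : ℝ → ℝ) : Prop :=
  ∀ x, ContinuousWithinAt f (Iic x) x ∧ ∃ l : ℝ, Tendsto f (𝓝[>] x) (𝓝 l)

/-- A pair of strictly increasing functions `W` (càdlàg) and `V` (càglàd) with periodic increments,
normalized by `W(0-) = W(0) = 0` and `V(0-) = V(0) = 0` (for `V`, the first equality is left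
continuity). Their induced measures may have atoms. -/
structure PeriodicPair where
  W : ℝ → ℝ
  V : ℝ → ℝ
  W_strictMono : StrictMono W
  V_strictMono : StrictMono V
  W_right_cont : ∀ x, ContinuousWithinAt W (Ici x) x
  V_left_cont : ∀ x, ContinuousWithinAt V (Iic x) x
  W_periodic : ∀ x, W (x + 1) - W x = W 1 - W 0
  V_periodic : ∀ x, V (x + 1) - V x = V 1 - V 0
  W_zero : W 0 = 0
  V_zero : V 0 = 0
  W_left_cont_zero : ContinuousWithinAt W (Iic 0) 0

namespace PeriodicPair

variable (p : PeriodicPair)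

/-- The measure `dW` on `𝕋 = [0, 1)`; `dW (a, b] = W b - W a` for `0 ≤ a ≤ b < 1`. -/
def muW : Measure ℝ :=
  (StieltjesFunction.mk p.W p.W_strictMono.monotone p.W_right_cont).measure.restrict (Ico 0 1)

/-- The measure `dV` on `𝕋 = [0, 1)`; `dV [a, b) = V b - V a` for `0 ≤ a ≤ b ≤ 1`. -/
def muV : Measure ℝ :=
  p.V_strictMono.monotone.stieltjesFunction.measure.restrict (Ico 0 1)

end PeriodicPair

/-- The difference quotient of `f` at `x` with respect to `U`. -/
def quot (U f : ℝ → ℝ) (x y : ℝ) : ℝ := (f y - f x) / (U y - U x)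

/-- `f` is `W`-left differentiable (at every point). -/
def LeftDifferentiable (W f : ℝ → ℝ) : Prop :=
  ∀ x, ∃ l : ℝ, Tendsto (quot W f x) (𝓝[<] x) (𝓝 l)

/-- `g` is `V`-right differentiable (at every point). -/
def RightDifferentiable (V g : ℝ → ℝ) : Prop :=
  ∀ x, ∃ l : ℝ, Tendsto (quot V g x) (𝓝[>] x) (𝓝 l)

/-- The pointwise left derivative `D_W^- f`. -/
def leftDeriv (W f : ℝ → ℝ) (x : ℝ) : ℝ := limUnder (𝓝[<] x) (quot W f x)

/-- The pointwise right derivative `D_V^+ g`. -/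
def rightDeriv (V g : ℝ → ℝ) (x : ℝ) : ℝ := limUnder (𝓝[>] x) (quot V g x)

/-- The strong domain of the operator `D_V^+ D_W^-` on the torus. -/
structure StrongDomain (p : PeriodicPair) (f : ℝ → ℝ) : Prop where
  periodic : Function.Periodic f 1
  cadlag : IsCadlag f
  left_diff : LeftDifferentiable p.W f
  deriv_caglad : IsCaglad (leftDeriv p.W f)
  right_diff : RightDifferentiable p.V (leftDeriv p.W f)
  second_cadlag : IsCadlag (rightDeriv p.V (leftDeriv p.W f))

/-- The squared energetic norm `⟨(I - D_V^+ D_W^-) f, f⟩_V` on the strong domain. -/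
def energySq (p : PeriodicPair) (f : ℝ → ℝ) : ℝ :=
  ∫ x, (f x - rightDeriv p.V (leftDeriv p.W f) x) * f x ∂p.muV

/-- Membership in `H_{W,V}(𝕋)`, the energetic space of `I - D_V^+ D_W^-`: `f ∈ L²_V(𝕋)` is the
`L²_V`-limit of a sequence of the strong domain that is Cauchy for the energetic norm. Members are
understood up to `V`-almost everywhere equality on `𝕋`. -/
def MemH (p : PeriodicPair) (f : ℝ → ℝ) : Prop :=
  MemLp f 2 p.muV ∧
    ∃ φ : ℕ → ℝ → ℝ, (∀ n, StrongDomain p (φ n)) ∧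
      Tendsto (fun n => eLpNorm (φ n - f) 2 p.muV) atTop (𝓝 0) ∧
      ∀ ε : ℝ, 0 < ε → ∃ N, ∀ m ≥ N, ∀ n ≥ N, energySq p (φ m - φ n) < ε

/-- `f(x) = c + ∫_{(0,x]} F dW` for `V`-a.e. `x ∈ 𝕋`, with `F ∈ L²_W(𝕋)` of `W`-mean zero. Such `F` is
the weak derivative `D_W^- f`, and `c` is the value at the tagged zero of the representative
on the right-hand side. -/
def HasWeakDeriv (p : PeriodicPair) (f : ℝ → ℝ) (c : ℝ) (F : ℝ → ℝ) : Prop :=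
  MemLp F 2 p.muW ∧ ∫ s, F s ∂p.muW = 0 ∧
    f =ᵐ[p.muV] fun x => c + ∫ s in Ioc 0 x, F s ∂p.muW

open Classical in
/-- The weak derivative `D_W^- f` (determined up to `W`-a.e. equality). -/
def weakDeriv (p : PeriodicPair) (f : ℝ → ℝ) : ℝ → ℝ :=
  if h : ∃ F : ℝ → ℝ, ∃ c : ℝ, HasWeakDeriv p f c F then h.choose else 0

/-- Membership in `H_{W,V,𝒟}(𝕋) = {f ∈ H_{W,V}(𝕋) : f(0) = 0}`. -/
def MemHD (p : PeriodicPair) (f : ℝ → ℝ) : Prop :=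
  MemH p f ∧ ∃ F : ℝ → ℝ, HasWeakDeriv p f 0 F

/-- The Dirichlet norm `(∫_𝕋 (D_W^- f)² dW)^{1/2}` of `H_{W,V,𝒟}(𝕋)`. -/
def dirichletNorm (p : PeriodicPair) (f : ℝ → ℝ) : ℝ :=
  Real.sqrt (∫ s, weakDeriv p f s ^ 2 ∂p.muW)

/-- `ℓ` is an element of `H^{-1}_{W,V,𝒟}(𝕋)`: a bounded linear functional on `H_{W,V,𝒟}(𝕋)`. -/
def MemDualHD (p : PeriodicPair) (ℓ : (ℝ → ℝ) → ℝ) : Prop :=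
  (∀ g₁ g₂ : ℝ → ℝ, MemHD p g₁ → MemHD p g₂ → ∀ a b : ℝ,
      ℓ (a • g₁ + b • g₂) = a * ℓ g₁ + b * ℓ g₂) ∧
    ∃ C : ℝ, ∀ g : ℝ → ℝ, MemHD p g → |ℓ g| ≤ C * dirichletNorm p g

/-- `B` (restricted to times in `[0, 1]`) is a `W`-Brownian motion on `[0, 1]` under `P`. -/
structure IsWBrownianMotion {Ω : Type*} [MeasurableSpace Ω] (W : ℝ → ℝ) (P : Measure Ω)
    (B : ℝ → Ω → ℝ) : Prop where
  measurable : ∀ t ∈ Icc (0 : ℝ) 1, Measurable (B t)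
  zero : ∀ᵐ ω ∂P, B 0 ω = 0
  indep : ∀ s ∈ Icc (0 : ℝ) 1, ∀ t ∈ Icc (0 : ℝ) 1, s < t →
    Indep (MeasurableSpace.comap (fun ω => B t ω - B s ω) inferInstance)
      (⨆ r ∈ Icc (0 : ℝ) s, MeasurableSpace.comap (B r) inferInstance) P
  increments : ∀ s ∈ Icc (0 : ℝ) 1, ∀ t ∈ Icc (0 : ℝ) 1, s < t →
    P.map (fun ω => B t ω - B s ω) = gaussianReal 0 (W t - W s).toNNReal
  cadlag : ∀ᵐ ω ∂P, IsCadlagOn (fun t => B t ω) (Icc 0 1)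

/-- The integrand `B(s-) D_W^- g(s)` of the white noise, for a path `b` of `B`. -/
def noiseIntegrand (p : PeriodicPair) (b : ℝ → ℝ) (g : ℝ → ℝ) (s : ℝ) : ℝ :=
  Function.leftLim b s * weakDeriv p g s

/-- The pathwise `W`-Gaussian white noise `g ↦ - ∫_𝕋 B(s-) D_W^- g(s) dW(s)`, for a path `b` of `B`. -/
def whiteNoise (p : PeriodicPair) (b : ℝ → ℝ) (g : ℝ → ℝ) : ℝ :=
  - ∫ s, noiseIntegrand p b g s ∂p.muW

/-- The bilinear form `∫_𝕋 κ² u g dV + ∫_𝕋 H D_W^- u D_W^- g dW`. -/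
def bilinearForm (p : PeriodicPair) (κ H u g : ℝ → ℝ) : ℝ :=
  ∫ x, κ x ^ 2 * u x * g x ∂p.muV + ∫ x, H x * weakDeriv p u x * weakDeriv p g x ∂p.muW

/-- `u ∈ H_{W,V,𝒟}(𝕋)` is a weak solution of `κ² u - D_V^+ (H D_W^- u) = ℓ` in `H_{W,V,𝒟}(𝕋)`. -/
def IsWeakSolution (p : PeriodicPair) (κ H : ℝ → ℝ) (ℓ : (ℝ → ℝ) → ℝ) (u : ℝ → ℝ) : Prop :=
  MemHD p u ∧ ∀ g : ℝ → ℝ, MemHD p g → bilinearForm p κ H u g = ℓ g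

end WVSobolev

end

/-!
Taking the weak derivative identifies `H_{W,V,𝒟}(𝕋)` with the Hilbert space `meanZero p` of
mean-zero elements of `L²_W(𝕋)`; the inverse map is `F ↦ ∫_{(0,x]} F dW` (`primW p 0 F`). Under
this identification the equation is a coercive variational problem, and the white noise is
`F ↦ -∫ B(s-) F(s) dW(s)`, a bounded functional because a càdlàg path is bounded on `[0, 1]`.
Lax–Milgram then gives existence and uniqueness path by path, and the solution is càdlàg because
it is a primitive with respect to `dW`.

The identification needs that every function with a weak derivative in `L²_W` is a limit of
functions of the strong domain (`HasWeakDeriv.memH`). These are obtained by integrating a càdlàg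
`h` first against `dV` and then against `dW` (`Admissible.strongDomain`); integration by parts
(`Admissible.energySq_strongFun`) turns the energetic norm into `‖φ‖²_V + ‖D_W^- φ‖²_W`. The
derivatives `D_W^- φ` so obtained are dense among mean-zero functions
(`mem_closure_strongDerivs`), since an element of `L²_W` orthogonal to all of them is constant
(`ae_eq_const_of_mem_orthogonal`). Uniqueness of the weak derivative (`HasWeakDeriv.unique`) holds
because `dV` charges every interval of `[0, 1)`.

For the measurability of `ω ↦ u(x, ω)`, the symmetry of the form yields
`u(x) = -∫ B(s-) ψ_x(s) dW(s)` with a deterministic `ψ_x`, the derivative of the Green function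
(`IsElliptic.primW_resolvent`); as `(s, ω) ↦ B(s-, ω)` coincides with a jointly measurable function
(`measurable_leftPath`), this integral is measurable in `ω`.
-/

noncomputable section

namespace WVSobolev

/-! ### The measures `dW` and `dV` -/

lemma apply_add_int {U : ℝ → ℝ} (h0 : U 0 = 0)
    (hU : ∀ x, U (x + 1) - U x = U 1 - U 0) (x : ℝ) (n : ℤ) : U (x + n) = U x + n * U 1 := by
  have h : ∀ y, U (y + 1) = U y + U 1 := fun y => by linarith [hU y]
  induction n using Int.induction_on with
  | zero => simp
  | succ i ih =>
    have := h (x + i)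
    push_cast at ih ⊢
    rw [← add_assoc, this, ih]; ring
  | pred i ih =>
    have := h (x + (-i - 1))
    push_cast at ih ⊢
    rw [show x + (-(i : ℝ) - 1) + 1 = x + -i by ring, ih] at this
    linarith

namespace PeriodicPair

variable (p : PeriodicPair)

instance : IsFiniteMeasure p.muW :=
  ⟨by rw [muW, Measure.restrict_apply_univ]; exact measure_Ico_lt_top⟩

instance : IsFiniteMeasure p.muV :=
  ⟨by rw [muV, Measure.restrict_apply_univ]; exact measure_Ico_lt_top⟩

lemma W_add_int (x : ℝ) (n : ℤ) : p.W (x + n) = p.W x + n * p.W 1 :=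
  apply_add_int p.W_zero p.W_periodic x n

lemma V_add_int (x : ℝ) (n : ℤ) : p.V (x + n) = p.V x + n * p.V 1 :=
  apply_add_int p.V_zero p.V_periodic x n

lemma W_left_cont_one : ContinuousWithinAt p.W (Iic 1) 1 := by
  have h : p.W = fun x => p.W (x - 1) + p.W 1 := by
    ext x
    have := p.W_add_int (x - 1) 1
    simpa using this
  rw [h]
  refine ContinuousWithinAt.add ?_ continuousWithinAt_const
  have h0 : ContinuousWithinAt p.W (Iic 0) ((1 : ℝ) - 1) := by
    rw [sub_self]; exact p.W_left_cont_zero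
  exact ContinuousWithinAt.comp (f := fun x : ℝ => x - 1) h0
    (by fun_prop) (fun x hx => by simpa using hx)

/-- The measure `dW` has no atoms at the end points of `[0, 1]`, so that the choice of the
fundamental domain is immaterial. -/
lemma muW_eq_restrict_Ioo : p.muW =
    (StieltjesFunction.mk p.W p.W_strictMono.monotone p.W_right_cont).measure.restrict
      (Ioo 0 1) := by
  refine Measure.restrict_congr_set ?_
  rw [← Ico_sdiff_left]
  refine (sdiff_null_ae_eq_self ?_).symm
  rw [StieltjesFunction.measure_singleton]
  have : Function.leftLim p.W 0 = p.W 0 :=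
    ContinuousWithinAt.leftLim_eq p.W_left_cont_zero
  change ENNReal.ofReal (p.W 0 - Function.leftLim p.W 0) = 0
  simp [this]

lemma muW_eq_restrict_Icc : p.muW =
    (StieltjesFunction.mk p.W p.W_strictMono.monotone p.W_right_cont).measure.restrict
      (Icc 0 1) := by
  refine Measure.restrict_congr_set ?_
  rw [← Icc_sdiff_right]
  refine (sdiff_null_ae_eq_self ?_)
  rw [StieltjesFunction.measure_singleton]
  have : Function.leftLim p.W 1 = p.W 1 :=
    ContinuousWithinAt.leftLim_eq p.W_left_cont_one
  change ENNReal.ofReal (p.W 1 - Function.leftLim p.W 1) = 0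
  simp [this]

lemma ae_muW_mem_Ioo : ∀ᵐ s ∂p.muW, s ∈ Ioo (0 : ℝ) 1 := by
  rw [muW_eq_restrict_Ioo]
  exact ae_restrict_mem measurableSet_Ioo

lemma ae_muV_mem_Ico : ∀ᵐ x ∂p.muV, x ∈ Ico (0 : ℝ) 1 :=
  ae_restrict_mem measurableSet_Ico

lemma muW_real_Ioc {a b : ℝ} (ha : 0 ≤ a) (hab : a ≤ b) (hb : b ≤ 1) :
    p.muW.real (Ioc a b) = p.W b - p.W a := by
  rw [measureReal_def, muW_eq_restrict_Icc, Measure.restrict_apply measurableSet_Ioc,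
    inter_eq_left.2 (Ioc_subset_Icc_self.trans (Icc_subset_Icc ha hb)),
    StieltjesFunction.measure_Ioc]
  exact ENNReal.toReal_ofReal (sub_nonneg.2 (p.W_strictMono.monotone hab))

lemma muV_real_Ico {a b : ℝ} (ha : 0 ≤ a) (hab : a ≤ b) (hb : b ≤ 1) :
    p.muV.real (Ico a b) = p.V b - p.V a := by
  have hl : ∀ x, Function.leftLim p.V_strictMono.monotone.stieltjesFunction x = p.V x := by
    intro x
    have h1 : (p.V_strictMono.monotone.stieltjesFunction : ℝ → ℝ) = Function.rightLim p.V := by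
      ext y; exact Monotone.stieltjesFunction_eq _ y
    rw [h1, leftLim_rightLim (p.V_strictMono.monotone.tendsto_leftLim x)]
    exact ContinuousWithinAt.leftLim_eq (p.V_left_cont x)
  rw [measureReal_def, muV, Measure.restrict_apply measurableSet_Ico,
    inter_eq_left.2 (Ico_subset_Ico ha hb), StieltjesFunction.measure_Ico, hl, hl]
  exact ENNReal.toReal_ofReal (sub_nonneg.2 (p.V_strictMono.monotone hab))

lemma muV_real_univ : p.muV.real univ = p.V 1 := by
  have := p.muV_real_Ico le_rfl zero_le_one le_rfl
  rw [p.V_zero, sub_zero] at this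
  rw [← this]
  exact measureReal_congr (eventuallyEq_univ.2 p.ae_muV_mem_Ico).symm

lemma muW_real_univ : p.muW.real univ = p.W 1 := by
  have := p.muW_real_Ioc le_rfl zero_le_one le_rfl
  rw [p.W_zero, sub_zero] at this
  rw [← this]
  refine measureReal_congr (eventuallyEq_univ.2 ?_).symm
  filter_upwards [p.ae_muW_mem_Ioo] with x hx using Ioo_subset_Ioc_self hx

lemma W_one_pos : 0 < p.W 1 := by
  have := p.W_strictMono zero_lt_one; rwa [p.W_zero] at this

lemma restrict_Ioc_zero_one : p.muW.restrict (Ioc 0 1) = p.muW := by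
  refine Measure.restrict_eq_self_of_ae_mem ?_
  filter_upwards [p.ae_muW_mem_Ioo] with x hx using Ioo_subset_Ioc_self hx

lemma restrict_Ico_zero_one : p.muV.restrict (Ico 0 1) = p.muV :=
  Measure.restrict_eq_self_of_ae_mem p.ae_muV_mem_Ico

end PeriodicPair

/-! ### Primitives -/

section Primitive

variable {μ : Measure ℝ} {F : ℝ → ℝ}

lemma tendsto_setIntegral_of_eventually_mem_iff (hF : Integrable F μ) {ι : Type*} {l : Filter ι}
    [l.IsCountablyGenerated] {A : ι → Set ℝ} {S : Set ℝ} (hA : ∀ i, MeasurableSet (A i))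
    (hS : MeasurableSet S) (h : ∀ s, ∀ᶠ i in l, (s ∈ A i ↔ s ∈ S)) :
    Tendsto (fun i => ∫ s in A i, F s ∂μ) l (𝓝 (∫ s in S, F s ∂μ)) := by
  simp_rw [← integral_indicator hS, fun i => (integral_indicator (hA i) (f := F) (μ := μ)).symm]
  refine tendsto_integral_filter_of_dominated_convergence (fun s => ‖F s‖) ?_ ?_ hF.norm ?_
  · exact Eventually.of_forall fun i => hF.aestronglyMeasurable.indicator (hA i)
  · exact Eventually.of_forall fun i => ae_of_all _ fun s => norm_indicator_le_norm_self _ _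
  · refine ae_of_all _ fun s => tendsto_nhds_of_eventually_eq ?_
    filter_upwards [h s] with i hi
    by_cases hs : s ∈ S
    · rw [indicator_of_mem hs, indicator_of_mem (hi.2 hs)]
    · rw [indicator_of_notMem hs, indicator_of_notMem (mt hi.1 hs)]

lemma isCadlag_setIntegral_Ioc (hF : Integrable F μ) (a : ℝ) :
    IsCadlag fun x => ∫ s in Ioc a x, F s ∂μ := by
  intro x
  refine ⟨?_, ∫ s in Ioo a x, F s ∂μ, ?_⟩
  · refine tendsto_setIntegral_of_eventually_mem_iff hF (fun _ => measurableSet_Ioc)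
      measurableSet_Ioc fun s => ?_
    rcases le_or_gt s x with hs | hs
    · filter_upwards [self_mem_nhdsWithin] with y hy
      simp [hs, hs.trans hy]
    · filter_upwards [mem_nhdsWithin_of_mem_nhds (Iio_mem_nhds hs)] with y hy
      simp [hs.not_ge, (mem_Iio.1 hy).not_ge]
  · refine tendsto_setIntegral_of_eventually_mem_iff hF (fun _ => measurableSet_Ioc)
      measurableSet_Ioo fun s => ?_
    rcases lt_or_ge s x with hs | hs
    · filter_upwards [mem_nhdsWithin_of_mem_nhds (Ioi_mem_nhds hs)] with y hy
      simp [hs, (mem_Ioi.1 hy).le]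
    · filter_upwards [self_mem_nhdsWithin] with y hy
      simp [hs.not_gt, ((mem_Iio.1 hy).trans_le hs).not_ge]

lemma isCaglad_setIntegral_Ico (hF : Integrable F μ) (a : ℝ) :
    IsCaglad fun x => ∫ s in Ico a x, F s ∂μ := by
  intro x
  refine ⟨?_, ∫ s in Icc a x, F s ∂μ, ?_⟩
  · refine tendsto_setIntegral_of_eventually_mem_iff hF (fun _ => measurableSet_Ico)
      measurableSet_Ico fun s => ?_
    rcases lt_or_ge s x with hs | hs
    · filter_upwards [mem_nhdsWithin_of_mem_nhds (Ioi_mem_nhds hs)] with y hy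
      simp [hs, mem_Ioi.1 hy]
    · filter_upwards [self_mem_nhdsWithin] with y hy
      simp [hs.not_gt, ((mem_Iic.1 hy).trans hs).not_gt]
  · refine tendsto_setIntegral_of_eventually_mem_iff hF (fun _ => measurableSet_Ico)
      measurableSet_Icc fun s => ?_
    rcases le_or_gt s x with hs | hs
    · filter_upwards [self_mem_nhdsWithin] with y hy
      simp [hs, hs.trans_lt (mem_Ioi.1 hy)]
    · filter_upwards [mem_nhdsWithin_of_mem_nhds (Iio_mem_nhds hs)] with y hy
      simp [hs.not_ge, (mem_Iio.1 hy).le.not_gt]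

lemma ae_eq_zero_of_forall_setIntegral_Iic_eq_zero (hF : Integrable F μ)
    (h0 : ∫ s, F s ∂μ = 0) (h : ∀ x, ∫ s in Iic x, F s ∂μ = 0) : F =ᵐ[μ] 0 := by
  have key : ∀ S, MeasurableSet S → ∫ s in S, F s ∂μ = 0 := by
    intro S hS
    induction S, hS using MeasurableSpace.induction_on_inter
      (BorelSpace.measurable_eq.trans (borel_eq_generateFrom_Iic ℝ)) isPiSystem_Iic with
    | empty => simp
    | basic S hS => obtain ⟨x, rfl⟩ := hS; exact h x
    | compl S hS ih =>
      have := integral_add_compl (μ := μ) (f := F) hS hF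
      linarith
    | iUnion f hd hf ih =>
      rw [integral_iUnion hf hd hF.integrableOn]
      simp [ih]
  exact hF.ae_eq_zero_of_forall_setIntegral_eq_zero fun S hS _ => key S hS

end Primitive

/-! ### One-sided continuity, measurability and periodization -/

/-- The largest point of the grid `ℤ / (n + 1)` that is strictly to the left of `x`. -/
def leftGrid (n : ℕ) (x : ℝ) : ℝ := (⌈((n : ℝ) + 1) * x⌉ - 1) / ((n : ℝ) + 1)

lemma leftGrid_lt (n : ℕ) (x : ℝ) : leftGrid n x < x := by
  have hn : (0 : ℝ) < (n : ℝ) + 1 := by positivity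
  rw [leftGrid, div_lt_iff₀ hn]
  linarith [Int.ceil_lt_add_one (((n : ℝ) + 1) * x)]

lemma le_leftGrid (n : ℕ) (x : ℝ) : x - 1 / ((n : ℝ) + 1) ≤ leftGrid n x := by
  have hn : (0 : ℝ) < (n : ℝ) + 1 := by positivity
  rw [leftGrid, le_div_iff₀ hn, sub_mul, div_mul_cancel₀ _ hn.ne']
  linarith [Int.le_ceil (((n : ℝ) + 1) * x)]

lemma tendsto_leftGrid (x : ℝ) : Tendsto (fun n => leftGrid n x) atTop (𝓝[<] x) := by
  refine tendsto_nhdsWithin_iff.2 ⟨?_, Eventually.of_forall fun n => leftGrid_lt n x⟩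
  have h : Tendsto (fun n : ℕ => x - 1 / ((n : ℝ) + 1)) atTop (𝓝 x) := by
    simpa using tendsto_const_nhds.sub (tendsto_one_div_add_atTop_nhds_zero_nat (𝕜 := ℝ))
  exact tendsto_of_tendsto_of_tendsto_of_le_of_le h tendsto_const_nhds
    (fun n => le_leftGrid n x) fun n => (leftGrid_lt n x).le

lemma measurable_comp_leftGrid (f : ℝ → ℝ) (n : ℕ) : Measurable fun x => f (leftGrid n x) :=
  (measurable_of_countable fun k : ℤ => f (((k : ℝ) - 1) / ((n : ℝ) + 1))).comp
    (Int.measurable_ceil.comp (measurable_const_mul _))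

lemma measurable_of_leftContinuous {f : ℝ → ℝ} (hf : ∀ x, ContinuousWithinAt f (Iic x) x) :
    Measurable f := by
  refine measurable_of_tendsto_metrizable (fun n => measurable_comp_leftGrid f n)
    (tendsto_pi_nhds.2 fun x => ?_)
  exact ((hf x).mono Iio_subset_Iic_self).tendsto.comp (tendsto_leftGrid x)

lemma IsCaglad.measurable {f : ℝ → ℝ} (hf : IsCaglad f) : Measurable f :=
  measurable_of_leftContinuous fun x => (hf x).1

lemma IsCadlag.measurable {f : ℝ → ℝ} (hf : IsCadlag f) : Measurable f := by
  have h : Measurable fun x => f (-x) := by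
    refine measurable_of_leftContinuous fun x => ?_
    exact ContinuousWithinAt.comp (t := Ici (-x)) (hf (-x)).1
      continuous_neg.continuousWithinAt fun y hy => mem_Ici.2 (neg_le_neg (mem_Iic.1 hy))
  simpa [Function.comp_def] using h.comp measurable_neg

lemma eventually_fract_eq_right (x : ℝ) : ∀ᶠ y : ℝ in 𝓝[≥] x, Int.fract y = y - (⌊x⌋ : ℤ) := by
  filter_upwards [self_mem_nhdsWithin,
    mem_nhdsWithin_of_mem_nhds (Iio_mem_nhds (Int.lt_floor_add_one x))] with y hy hy'
  rw [Int.fract, Int.floor_eq_iff.2 ⟨(Int.floor_le x).trans hy, hy'⟩]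

lemma eventually_fract_eq_left (x : ℝ) :
    ∀ᶠ y : ℝ in 𝓝[<] x, Int.fract y = y - (⌈x⌉ - 1 : ℤ) := by
  have h1 : ((⌈x⌉ - 1 : ℤ) : ℝ) < x := by
    push_cast; linarith [Int.ceil_lt_add_one x]
  filter_upwards [self_mem_nhdsWithin, mem_nhdsWithin_of_mem_nhds (Ioi_mem_nhds h1)] with y hy hy'
  rw [Int.fract, Int.floor_eq_iff.2 ⟨(mem_Ioi.1 hy').le, ?_⟩]
  push_cast
  linarith [Int.le_ceil x, mem_Iio.1 hy]

lemma tendsto_sub_nhdsLT (x c : ℝ) : Tendsto (fun y => y - c) (𝓝[<] x) (𝓝[<] (x - c)) :=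
  tendsto_nhdsWithin_of_tendsto_nhds_of_eventually_within _
    ((continuous_id.sub continuous_const).continuousWithinAt.tendsto)
    (by filter_upwards [self_mem_nhdsWithin] with y hy using sub_lt_sub_right hy c)

lemma tendsto_sub_nhdsGT (x c : ℝ) : Tendsto (fun y => y - c) (𝓝[>] x) (𝓝[>] (x - c)) :=
  tendsto_nhdsWithin_of_tendsto_nhds_of_eventually_within _
    ((continuous_id.sub continuous_const).continuousWithinAt.tendsto)
    (by filter_upwards [self_mem_nhdsWithin] with y hy using sub_lt_sub_right hy c)

/-- For a function with equal values at `0` and `1`, the periodic extensions from `[0, 1)` and from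
`(0, 1]` agree. -/
lemma comp_fract_eq {f : ℝ → ℝ} (h : f 0 = f 1) (x : ℝ) :
    f (Int.fract x) = f (x - (⌈x⌉ - 1 : ℤ)) := by
  by_cases hx : Int.fract x = 0
  · have h1 : (⌈x⌉ : ℝ) = x := by
      rw [Int.fract_eq_zero_iff] at hx
      obtain ⟨z, rfl⟩ := hx
      simp
    rw [hx, h]; congr 1
    push_cast; rw [h1]; ring
  · congr 1
    have h2 : ⌈x⌉ = ⌊x⌋ + 1 := by
      rw [Int.ceil_eq_iff]
      have := Int.fract_pos.2 (fun h => hx (by rw [Int.fract, ← h, sub_self]))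
      have := Int.self_sub_floor x
      push_cast
      exact ⟨by linarith, (Int.lt_floor_add_one x).le⟩
    rw [h2, Int.fract]; push_cast; ring

lemma IsCadlag.comp_fract {f : ℝ → ℝ} (hf : IsCadlag f) : IsCadlag fun x => f (Int.fract x) := by
  intro x
  constructor
  · have h1 : ContinuousWithinAt (fun y => f (y - ⌊x⌋)) (Ici x) x :=
      ContinuousWithinAt.comp (t := Ici (x - ⌊x⌋)) (hf (x - ⌊x⌋)).1
        (continuous_id.sub continuous_const).continuousWithinAt
        fun y hy => mem_Ici.2 (sub_le_sub_right (mem_Ici.1 hy) _)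
    refine h1.congr_of_eventuallyEq ?_ rfl
    filter_upwards [eventually_fract_eq_right x] with y hy
    rw [hy]
  · obtain ⟨l, hl⟩ := (hf (x - (⌈x⌉ - 1 : ℤ))).2
    refine ⟨l, (hl.comp (tendsto_sub_nhdsLT x _)).congr' ?_⟩
    filter_upwards [eventually_fract_eq_left x] with y hy
    rw [hy]; rfl

lemma IsCaglad.comp_fract {f : ℝ → ℝ} (hf : IsCaglad f) (h : f 0 = f 1) :
    IsCaglad fun x => f (Int.fract x) := by
  intro x
  constructor
  · have h1 : ContinuousWithinAt (fun y => f (y - (⌈x⌉ - 1 : ℤ))) (Iic x) x :=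
      ContinuousWithinAt.comp (t := Iic (x - (⌈x⌉ - 1 : ℤ))) (hf (x - (⌈x⌉ - 1 : ℤ))).1
        (continuous_id.sub continuous_const).continuousWithinAt
        fun y hy => mem_Iic.2 (sub_le_sub_right (mem_Iic.1 hy) _)
    rw [← continuousWithinAt_Iio_iff_Iic] at h1 ⊢
    refine h1.congr_of_eventuallyEq ?_ (comp_fract_eq h x)
    filter_upwards [eventually_fract_eq_left x] with y hy
    rw [hy]
  · obtain ⟨l, hl⟩ := (hf (x - ⌊x⌋)).2
    refine ⟨l, (hl.comp (tendsto_sub_nhdsGT x _)).congr' ?_⟩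
    filter_upwards [nhdsWithin_mono x Ioi_subset_Ici_self (eventually_fract_eq_right x)] with y hy
    rw [hy]; rfl

/-! ### Uniqueness of the weak derivative -/

variable {p : PeriodicPair}

/-- Since `V` is strictly increasing, `dV` charges every interval of `[0, 1)`; hence
right-continuous representatives are unique pointwise. -/
lemma IsCadlag.eqOn_of_ae_eq {f g : ℝ → ℝ} (hf : IsCadlag f) (hg : IsCadlag g)
    (h : f =ᵐ[p.muV] g) : EqOn f g (Ico 0 1) := by
  intro x hx
  by_contra hne
  have h1 : ∀ᶠ y in 𝓝[≥] x, f y - g y ≠ 0 :=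
    ((hf x).1.sub (hg x).1).eventually_ne (sub_ne_zero.2 hne)
  obtain ⟨c, hc, hsub⟩ := mem_nhdsGE_iff_exists_Ico_subset.1 h1
  have hxc : x < min c 1 := lt_min hc hx.2
  have h2 : p.muV.real (Ico x (min c 1)) = p.V (min c 1) - p.V x :=
    p.muV_real_Ico hx.1 hxc.le (min_le_right _ _)
  have h3 : p.muV (Ico x (min c 1)) = 0 := by
    refine measure_mono_null (fun y hy => ?_) (ae_iff.1 h)
    exact sub_ne_zero.1 (hsub ⟨hy.1, hy.2.trans_le (min_le_left _ _)⟩)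
  rw [measureReal_def, h3] at h2
  have := p.V_strictMono hxc
  simp at h2
  linarith

/-- The representative `x ↦ c + ∫_{(0,x]} F dW`. -/
def primW (p : PeriodicPair) (c : ℝ) (F : ℝ → ℝ) (x : ℝ) : ℝ := c + ∫ s in Ioc 0 x, F s ∂p.muW

lemma isCadlag_primW {F : ℝ → ℝ} (c : ℝ) (hF : Integrable F p.muW) : IsCadlag (primW p c F) :=
  fun x => ⟨continuousWithinAt_const.add (isCadlag_setIntegral_Ioc hF 0 x).1,
    let ⟨l, hl⟩ := (isCadlag_setIntegral_Ioc hF 0 x).2; ⟨c + l, hl.const_add c⟩⟩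

@[simp] lemma primW_zero (c : ℝ) (F : ℝ → ℝ) : primW p c F 0 = c := by simp [primW]

lemma primW_one (c : ℝ) (F : ℝ → ℝ) : primW p c F 1 = c + ∫ s, F s ∂p.muW := by
  rw [primW, p.restrict_Ioc_zero_one]

lemma primW_congr {F G : ℝ → ℝ} (c : ℝ) (h : F =ᵐ[p.muW] G) : primW p c F = primW p c G := by
  ext x
  rw [primW, primW, integral_congr_ae (ae_restrict_of_ae h)]

lemma HasWeakDeriv.integrable {f F : ℝ → ℝ} {c : ℝ} (h : HasWeakDeriv p f c F) :
    Integrable F p.muW := h.1.integrable (by norm_num)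

lemma HasWeakDeriv.unique {f₁ f₂ F₁ F₂ : ℝ → ℝ} {c₁ c₂ : ℝ} (h₁ : HasWeakDeriv p f₁ c₁ F₁)
    (h₂ : HasWeakDeriv p f₂ c₂ F₂) (h : f₁ =ᵐ[p.muV] f₂) : c₁ = c₂ ∧ F₁ =ᵐ[p.muW] F₂ := by
  have heq : EqOn (primW p c₁ F₁) (primW p c₂ F₂) (Ico 0 1) :=
    (isCadlag_primW c₁ h₁.integrable).eqOn_of_ae_eq (isCadlag_primW c₂ h₂.integrable)
      ((h₁.2.2.symm.trans h).trans h₂.2.2)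
  have hc : c₁ = c₂ := by simpa using heq (left_mem_Ico.2 zero_lt_one)
  refine ⟨hc, ?_⟩
  have hint := h₁.integrable.sub h₂.integrable
  have htot : ∫ s, (F₁ - F₂) s ∂p.muW = 0 := by
    simp only [Pi.sub_apply]
    rw [integral_sub h₁.integrable h₂.integrable, h₁.2.1, h₂.2.1, sub_zero]
  have hz := ae_eq_zero_of_forall_setIntegral_Iic_eq_zero hint htot fun x => ?_
  · filter_upwards [hz] with s hs using sub_eq_zero.1 hs
  rcases lt_or_ge x 0 with hx | hx
  · refine setIntegral_measure_zero _ (measure_mono_null (fun y hy => ?_)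
      (ae_iff.1 p.ae_muW_mem_Ioo))
    exact fun hy' => absurd (hy'.1.trans_le hy) hx.not_gt
  have hIoc : Iic x =ᵐ[p.muW] Ioc 0 x := by
    filter_upwards [p.ae_muW_mem_Ioo] with s hs
    exact propext ⟨fun h => ⟨hs.1, h⟩, fun h => h.2⟩
  rcases lt_or_ge x 1 with hx1 | hx1
  · have := heq ⟨hx, hx1⟩
    rw [primW, primW, hc, add_right_inj] at this
    rw [setIntegral_congr_set hIoc]
    simp only [Pi.sub_apply]
    rw [integral_sub h₁.integrable.integrableOn h₂.integrable.integrableOn, this, sub_self]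
  · rw [Measure.restrict_eq_self_of_ae_mem, htot]
    filter_upwards [p.ae_muW_mem_Ioo] with s hs using hs.2.le.trans hx1

lemma HasWeakDeriv.weakDeriv {f F : ℝ → ℝ} {c : ℝ} (h : HasWeakDeriv p f c F) :
    HasWeakDeriv p f c (weakDeriv p f) ∧ weakDeriv p f =ᵐ[p.muW] F := by
  have hex : ∃ F : ℝ → ℝ, ∃ c : ℝ, HasWeakDeriv p f c F := ⟨F, c, h⟩
  have hw : WVSobolev.weakDeriv p f = hex.choose := by
    rw [WVSobolev.weakDeriv, dif_pos hex]
  obtain ⟨c', hc'⟩ := hex.choose_spec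
  rw [← hw] at hc'
  obtain ⟨rfl, hF⟩ := hc'.unique h EventuallyEq.rfl
  exact ⟨hc', hF⟩

/-! ### Elements of the strong domain with a prescribed second derivative -/

/-- The averages of `G` over sets that shrink to a point where `G` has the one-sided limit `g`
converge to `g`. -/
lemma tendsto_of_eventually_eq_average {μ : Measure ℝ} [IsFiniteMeasure μ] {G : ℝ → ℝ}
    (hG : Integrable G μ) {l : Filter ℝ} {S : ℝ → Set ℝ} {q : ℝ → ℝ} {g : ℝ}
    (hlim : ∀ ε > 0, ∀ᶠ y in l, ∀ s ∈ S y, |G s - g| ≤ ε)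
    (hq : ∀ᶠ y in l, 0 < μ.real (S y) ∧ q y = (∫ s in S y, G s ∂μ) / μ.real (S y)) :
    Tendsto q l (𝓝 g) := by
  rw [Metric.tendsto_nhds]
  intro ε hε
  filter_upwards [hlim (ε / 2) (half_pos hε), hq] with y h1 ⟨hpos, hqy⟩
  have h2 : ∫ s in S y, (G s - g) ∂μ = (∫ s in S y, G s ∂μ) - g * μ.real (S y) := by
    rw [integral_sub hG.integrableOn (integrable_const g)]
    simp [mul_comm]
  have h3 : ‖∫ s in S y, (G s - g) ∂μ‖ ≤ ε / 2 * μ.real (S y) :=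
    norm_setIntegral_le_of_norm_le_const (measure_lt_top _ _) fun s hs => h1 s hs
  rw [Real.dist_eq, hqy, div_sub' hpos.ne', abs_div, abs_of_pos hpos, div_lt_iff₀ hpos,
    mul_comm (μ.real _) g, ← h2]
  rw [Real.norm_eq_abs] at h3
  nlinarith

/-- The function `s ↦ d + ∫_{[0,s)} h dV`. -/
def primV (p : PeriodicPair) (d : ℝ) (h : ℝ → ℝ) (s : ℝ) : ℝ := d + ∫ t in Ico 0 s, h t ∂p.muV

lemma isCaglad_primV {h : ℝ → ℝ} (d : ℝ) (hh : Integrable h p.muV) : IsCaglad (primV p d h) :=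
  fun x => ⟨continuousWithinAt_const.add (isCaglad_setIntegral_Ico hh 0 x).1,
    let ⟨l, hl⟩ := (isCaglad_setIntegral_Ico hh 0 x).2; ⟨d + l, hl.const_add d⟩⟩

@[simp] lemma primV_zero (d : ℝ) (h : ℝ → ℝ) : primV p d h 0 = d := by simp [primV]

lemma primV_one (d : ℝ) (h : ℝ → ℝ) : primV p d h 1 = d + ∫ t, h t ∂p.muV := by
  rw [primV, p.restrict_Ico_zero_one]

lemma abs_primV_le {h : ℝ → ℝ} (d : ℝ) (hh : Integrable h p.muV) (s : ℝ) :
    |primV p d h s| ≤ |d| + ∫ t, |h t| ∂p.muV := by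
  refine (abs_add_le _ _).trans (add_le_add_right ?_ _)
  exact (norm_integral_le_integral_norm _).trans
    (setIntegral_le_integral hh.norm (ae_of_all _ fun _ => norm_nonneg _))

lemma abs_primW_le {F : ℝ → ℝ} (c : ℝ) (hF : Integrable F p.muW) (s : ℝ) :
    |primW p c F s| ≤ |c| + ∫ t, |F t| ∂p.muW := by
  refine (abs_add_le _ _).trans (add_le_add_right ?_ _)
  exact (norm_integral_le_integral_norm _).trans
    (setIntegral_le_integral hF.norm (ae_of_all _ fun _ => norm_nonneg _))

lemma memLp_primV {h : ℝ → ℝ} (d : ℝ) (hh : Integrable h p.muV) (μ : Measure ℝ)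
    [IsFiniteMeasure μ] {q : ENNReal} : MemLp (primV p d h) q μ :=
  MemLp.of_bound (isCaglad_primV d hh).measurable.aestronglyMeasurable _
    (ae_of_all _ (abs_primV_le d hh))

lemma memLp_primW {F : ℝ → ℝ} (c : ℝ) (hF : Integrable F p.muW) (μ : Measure ℝ)
    [IsFiniteMeasure μ] {q : ENNReal} : MemLp (primW p c F) q μ :=
  MemLp.of_bound (isCadlag_primW c hF).measurable.aestronglyMeasurable _
    (ae_of_all _ (abs_primW_le c hF))

lemma tendsto_quot_primW {G : ℝ → ℝ} (c : ℝ) (hG : Integrable G p.muW) {x : ℝ}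
    (hx : x ∈ Ioc 0 1) (hGx : ContinuousWithinAt G (Iic x) x) :
    Tendsto (quot p.W (primW p c G) x) (𝓝[<] x) (𝓝 (G x)) := by
  refine tendsto_of_eventually_eq_average (S := fun y => Ioc y x) hG
    (fun ε hε => ?_) ?_
  · obtain ⟨a, ha, hsub⟩ := mem_nhdsLE_iff_exists_Ioc_subset.1
      (hGx.preimage_mem_nhdsWithin (Metric.closedBall_mem_nhds (G x) hε))
    filter_upwards [Ico_mem_nhdsLT ha] with y hy s hs
    exact hsub ⟨hy.1.trans_lt hs.1, hs.2⟩
  · filter_upwards [Ico_mem_nhdsLT hx.1] with y hy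
    have hm := p.muW_real_Ioc hy.1 hy.2.le hx.2
    have hW := p.W_strictMono hy.2
    refine ⟨by rw [hm]; linarith, ?_⟩
    have hun : ∫ s in Ioc 0 x, G s ∂p.muW =
        (∫ s in Ioc 0 y, G s ∂p.muW) + ∫ s in Ioc y x, G s ∂p.muW := by
      rw [← Ioc_union_Ioc_eq_Ioc hy.1 hy.2.le,
        setIntegral_union (Ioc_disjoint_Ioc_of_le le_rfl) measurableSet_Ioc hG.integrableOn
          hG.integrableOn]
    rw [quot, hm, primW, primW, hun, ← neg_sub (p.W x), div_neg, ← neg_div]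
    congr 1; ring

lemma tendsto_quot_primV {h : ℝ → ℝ} (d : ℝ) (hh : Integrable h p.muV) {x : ℝ}
    (hx : x ∈ Ico 0 1) (hhx : ContinuousWithinAt h (Ici x) x) :
    Tendsto (quot p.V (primV p d h) x) (𝓝[>] x) (𝓝 (h x)) := by
  refine tendsto_of_eventually_eq_average (S := fun y => Ico x y) hh
    (fun ε hε => ?_) ?_
  · obtain ⟨a, ha, hsub⟩ := mem_nhdsGE_iff_exists_Ico_subset.1
      (hhx.preimage_mem_nhdsWithin (Metric.closedBall_mem_nhds (h x) hε))
    filter_upwards [Ioc_mem_nhdsGT ha] with y hy s hs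
    exact hsub ⟨hs.1, hs.2.trans_le hy.2⟩
  · filter_upwards [Ioc_mem_nhdsGT hx.2] with y hy
    have hm := p.muV_real_Ico hx.1 hy.1.le hy.2
    have hV := p.V_strictMono hy.1
    refine ⟨by rw [hm]; linarith, ?_⟩
    have hun : ∫ s in Ico 0 y, h s ∂p.muV =
        (∫ s in Ico 0 x, h s ∂p.muV) + ∫ s in Ico x y, h s ∂p.muV := by
      rw [← Ico_union_Ico_eq_Ico hx.1 hy.1.le,
        setIntegral_union Ico_disjoint_Ico_same measurableSet_Ico hh.integrableOn
          hh.integrableOn]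
    rw [quot, hm, primV, primV, hun]
    congr 1; ring

lemma tendsto_quot_comp_fract_left {f : ℝ → ℝ} {g : ℝ → ℝ} (hf : f 0 = f 1) (hg : g 0 = g 1)
    (h : ∀ x ∈ Ioc (0 : ℝ) 1, Tendsto (quot p.W f x) (𝓝[<] x) (𝓝 (g x))) (x : ℝ) :
    Tendsto (quot p.W (fun y => f (Int.fract y)) x) (𝓝[<] x) (𝓝 (g (Int.fract x))) := by
  set m : ℤ := ⌈x⌉ - 1 with hm
  have hmem : x - (m : ℝ) ∈ Ioc (0 : ℝ) 1 := by
    rw [hm]; push_cast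
    constructor <;> linarith [Int.le_ceil x, Int.ceil_lt_add_one x]
  rw [comp_fract_eq hg]
  refine ((h _ hmem).comp (tendsto_sub_nhdsLT x m)).congr' ?_
  filter_upwards [eventually_fract_eq_left x] with y hy
  have h1 := p.W_add_int (y - m) m
  have h2 := p.W_add_int (x - m) m
  rw [sub_add_cancel] at h1 h2
  simp only [quot, Function.comp_apply]
  rw [hy, comp_fract_eq hf x, ← hm, h1, h2]
  congr 1; ring

lemma tendsto_quot_comp_fract_right {f : ℝ → ℝ} {g : ℝ → ℝ}
    (h : ∀ x ∈ Ico (0 : ℝ) 1, Tendsto (quot p.V f x) (𝓝[>] x) (𝓝 (g x))) (x : ℝ) :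
    Tendsto (quot p.V (fun y => f (Int.fract y)) x) (𝓝[>] x) (𝓝 (g (Int.fract x))) := by
  refine ((h _ ⟨Int.fract_nonneg x, Int.fract_lt_one x⟩).comp
    (tendsto_sub_nhdsGT x ⌊x⌋)).congr' ?_
  filter_upwards [nhdsWithin_mono x Ioi_subset_Ici_self (eventually_fract_eq_right x)] with y hy
  have h1 := p.V_add_int (y - ⌊x⌋) ⌊x⌋
  have h2 := p.V_add_int (Int.fract x) ⌊x⌋
  rw [sub_add_cancel] at h1
  rw [Int.fract_add_floor] at h2
  simp only [quot, Function.comp_apply]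
  rw [hy, h1, h2]
  congr 1; ring

/-- The data `(d, h)` of a second derivative `h` and of an integration constant `d` for which
`c + ∫_{(0,x]} (d + ∫_{[0,s)} h dV) dW(s)` closes up to an element of the strong domain. -/
structure Admissible (p : PeriodicPair) (d : ℝ) (h : ℝ → ℝ) : Prop where
  cadlag : IsCadlag h
  integrable : Integrable h p.muV
  integral_eq : ∫ t, h t ∂p.muV = 0
  integral_primV_eq : ∫ s, primV p d h s ∂p.muW = 0

/-- The periodic function with value `c` at `0`, first derivative `d` at `0` and second derivative
`h`. -/
def strongFun (p : PeriodicPair) (c d : ℝ) (h : ℝ → ℝ) (x : ℝ) : ℝ :=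
  primW p c (primV p d h) (Int.fract x)

namespace Admissible

variable {d : ℝ} {h : ℝ → ℝ}

lemma integrable_primV (H : Admissible p d h) : Integrable (primV p d h) p.muW :=
  (memLp_primV (q := 1) d H.integrable p.muW).integrable le_rfl

lemma primV_zero_eq_one (H : Admissible p d h) : primV p d h 0 = primV p d h 1 := by
  rw [primV_one, H.integral_eq, primV_zero, add_zero]

lemma tendsto_quot_strongFun (H : Admissible p d h) (c x : ℝ) :
    Tendsto (quot p.W (strongFun p c d h) x) (𝓝[<] x) (𝓝 (primV p d h (Int.fract x))) := by
  refine tendsto_quot_comp_fract_left (f := primW p c (primV p d h)) ?_ H.primV_zero_eq_one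
    (fun y hy => ?_) x
  · rw [primW_one, H.integral_primV_eq, primW_zero, add_zero]
  · exact tendsto_quot_primW c H.integrable_primV hy (isCaglad_primV d H.integrable y).1

lemma leftDeriv_strongFun (H : Admissible p d h) (c : ℝ) :
    leftDeriv p.W (strongFun p c d h) = fun x => primV p d h (Int.fract x) :=
  funext fun x => (H.tendsto_quot_strongFun c x).limUnder_eq

lemma tendsto_quot_leftDeriv (H : Admissible p d h) (c x : ℝ) :
    Tendsto (quot p.V (leftDeriv p.W (strongFun p c d h)) x) (𝓝[>] x) (𝓝 (h (Int.fract x))) := by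
  rw [H.leftDeriv_strongFun]
  exact tendsto_quot_comp_fract_right
    (fun y hy => tendsto_quot_primV d H.integrable hy (H.cadlag y).1) x

lemma rightDeriv_leftDeriv (H : Admissible p d h) (c : ℝ) :
    rightDeriv p.V (leftDeriv p.W (strongFun p c d h)) = fun x => h (Int.fract x) :=
  funext fun x => (H.tendsto_quot_leftDeriv c x).limUnder_eq

lemma strongDomain (H : Admissible p d h) (c : ℝ) : StrongDomain p (strongFun p c d h) where
  periodic := fun x => by simp [strongFun]
  cadlag := (isCadlag_primW c H.integrable_primV).comp_fract
  left_diff := fun x => ⟨_, H.tendsto_quot_strongFun c x⟩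
  deriv_caglad := by
    rw [H.leftDeriv_strongFun]
    exact (isCaglad_primV d H.integrable).comp_fract H.primV_zero_eq_one
  right_diff := fun x => ⟨_, H.tendsto_quot_leftDeriv c x⟩
  second_cadlag := by
    rw [H.rightDeriv_leftDeriv]
    exact H.cadlag.comp_fract

/-- Integration by parts on the torus, by Fubini on the triangle `0 < s ≤ x < 1`. -/
lemma integral_mul_primW (H : Admissible p d h) (c : ℝ) :
    ∫ x, h x * primW p c (primV p d h) x ∂p.muV = -∫ s, primV p d h s ^ 2 ∂p.muW := by
  set G := primV p d h with hG
  set T : Set (ℝ × ℝ) := {q | q.2 ∈ Ioc 0 q.1} with hT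
  have hTm : MeasurableSet T :=
    (measurableSet_lt measurable_const measurable_snd).inter
      (measurableSet_le measurable_snd measurable_fst)
  have hint : Integrable (T.indicator fun q : ℝ × ℝ => h q.1 * G q.2) (p.muV.prod p.muW) :=
    (H.integrable.mul_prod H.integrable_primV).indicator hTm
  have hsplit : ∫ x, h x * primW p c G x ∂p.muV =
      ∫ x, h x * ∫ s in Ioc 0 x, G s ∂p.muW ∂p.muV := by
    have h2 : Integrable (fun x => h x * ∫ s in Ioc 0 x, G s ∂p.muW) p.muV := by
      have := (memLp_primW (q := ⊤) 0 H.integrable_primV p.muV)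
      have e : primW p 0 (primV p d h) = fun x => ∫ s in Ioc 0 x, G s ∂p.muW := by
        ext x; simp [primW, hG]
      rw [e] at this
      exact H.integrable.mul_of_top_left this
    simp_rw [primW, mul_add]
    rw [integral_add (H.integrable.mul_const c) h2, integral_mul_const, H.integral_eq, zero_mul,
      zero_add]
  have hleft : ∀ x, (∫ s, T.indicator (fun q : ℝ × ℝ => h q.1 * G q.2) (x, s) ∂p.muW) =
      h x * ∫ s in Ioc 0 x, G s ∂p.muW := by
    intro x
    rw [← integral_const_mul, ← integral_indicator measurableSet_Ioc]
    rfl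
  have hright : ∀ᵐ s ∂p.muW, (∫ x, T.indicator (fun q : ℝ × ℝ => h q.1 * G q.2) (x, s) ∂p.muV) =
      d * G s - G s ^ 2 := by
    filter_upwards [p.ae_muW_mem_Ioo] with s hs
    have h1 : ∀ x, T.indicator (fun q : ℝ × ℝ => h q.1 * G q.2) (x, s) =
        (Ici s).indicator (fun x => h x * G s) x := fun x => by
      simp [indicator, hT, hs.1]
    simp_rw [h1]
    rw [integral_indicator measurableSet_Ici, integral_mul_const]
    have h2 := integral_add_compl (μ := p.muV) (f := h) (s := Ici s) measurableSet_Ici H.integrable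
    have h3 : Iio s =ᵐ[p.muV] Ico 0 s := by
      filter_upwards [p.ae_muV_mem_Ico] with x hx
      exact propext ⟨fun h => ⟨hx.1, h⟩, fun h => h.2⟩
    rw [compl_Ici, setIntegral_congr_set h3, H.integral_eq] at h2
    have h4 : G s = d + ∫ t in Ico 0 s, h t ∂p.muV := rfl
    have h5 : ∫ x in Ici s, h x ∂p.muV = d - G s := by linarith
    rw [h5]; ring
  have hsq : Integrable (fun s => G s ^ 2) p.muW := (memLp_primV d H.integrable p.muW).integrable_sq
  calc ∫ x, h x * primW p c G x ∂p.muV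
      = ∫ x, ∫ s, T.indicator (fun q : ℝ × ℝ => h q.1 * G q.2) (x, s) ∂p.muW ∂p.muV := by
        rw [hsplit]; simp_rw [hleft]
    _ = ∫ s, ∫ x, T.indicator (fun q : ℝ × ℝ => h q.1 * G q.2) (x, s) ∂p.muV ∂p.muW :=
        integral_integral_swap hint
    _ = ∫ s, (d * G s - G s ^ 2) ∂p.muW := integral_congr_ae hright
    _ = -∫ s, G s ^ 2 ∂p.muW := by
        rw [integral_sub (H.integrable_primV.const_mul d) hsq, integral_const_mul,
          H.integral_primV_eq, mul_zero, zero_sub]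

lemma energySq_strongFun (H : Admissible p d h) (c : ℝ) :
    energySq p (strongFun p c d h) =
      ∫ x, primW p c (primV p d h) x ^ 2 ∂p.muV + ∫ s, primV p d h s ^ 2 ∂p.muW := by
  have hφ := memLp_primW (q := ⊤) c H.integrable_primV p.muV
  have h1 : energySq p (strongFun p c d h) = ∫ x, (primW p c (primV p d h) x ^ 2 -
      h x * primW p c (primV p d h) x) ∂p.muV := by
    rw [energySq, H.rightDeriv_leftDeriv]
    refine integral_congr_ae ?_
    filter_upwards [p.ae_muV_mem_Ico] with x hx
    simp only [strongFun]
    rw [Int.fract_eq_self.2 hx]; ring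
  have h2 : Integrable (fun x => h x * primW p c (primV p d h) x) p.muV :=
    H.integrable.mul_of_top_left hφ
  rw [h1, integral_sub (memLp_primW c H.integrable_primV p.muV).integrable_sq h2,
    H.integral_mul_primW c, sub_neg_eq_add]

end Admissible

/-! ### Density of the derivatives of the strong domain -/

lemma primV_add {h₁ h₂ : ℝ → ℝ} (d₁ d₂ : ℝ) (H₁ : Integrable h₁ p.muV) (H₂ : Integrable h₂ p.muV) :
    primV p (d₁ + d₂) (h₁ + h₂) = primV p d₁ h₁ + primV p d₂ h₂ := by
  ext s
  simp only [primV, Pi.add_apply]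
  rw [integral_add H₁.integrableOn H₂.integrableOn]; ring

lemma primV_smul (a d : ℝ) (h : ℝ → ℝ) : primV p (a * d) (a • h) = a • primV p d h := by
  ext s
  simp only [primV, Pi.smul_apply, smul_eq_mul]
  rw [integral_const_mul]; ring

lemma IsCadlag.add {f g : ℝ → ℝ} (hf : IsCadlag f) (hg : IsCadlag g) : IsCadlag (f + g) :=
  fun x => ⟨(hf x).1.add (hg x).1, let ⟨l, hl⟩ := (hf x).2; let ⟨m, hm⟩ := (hg x).2
    ⟨l + m, hl.add hm⟩⟩

lemma IsCadlag.smul {f : ℝ → ℝ} (hf : IsCadlag f) (a : ℝ) : IsCadlag (a • f) :=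
  fun x => ⟨(hf x).1.const_smul a, let ⟨l, hl⟩ := (hf x).2; ⟨a • l, hl.const_smul a⟩⟩

lemma Admissible.add {d₁ d₂ : ℝ} {h₁ h₂ : ℝ → ℝ} (H₁ : Admissible p d₁ h₁)
    (H₂ : Admissible p d₂ h₂) : Admissible p (d₁ + d₂) (h₁ + h₂) where
  cadlag := H₁.cadlag.add H₂.cadlag
  integrable := H₁.integrable.add H₂.integrable
  integral_eq := by
    simp only [Pi.add_apply]
    rw [integral_add H₁.integrable H₂.integrable, H₁.integral_eq, H₂.integral_eq, add_zero]
  integral_primV_eq := by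
    rw [primV_add _ _ H₁.integrable H₂.integrable]
    simp only [Pi.add_apply]
    rw [integral_add H₁.integrable_primV H₂.integrable_primV, H₁.integral_primV_eq,
      H₂.integral_primV_eq, add_zero]

lemma Admissible.smul {d : ℝ} {h : ℝ → ℝ} (H : Admissible p d h) (a : ℝ) :
    Admissible p (a * d) (a • h) where
  cadlag := H.cadlag.smul a
  integrable := H.integrable.smul a
  integral_eq := by
    simp only [Pi.smul_apply]
    rw [integral_smul, H.integral_eq, smul_zero]
  integral_primV_eq := by
    rw [primV_smul]
    simp only [Pi.smul_apply]
    rw [integral_smul, H.integral_primV_eq, smul_zero]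

lemma admissible_zero : Admissible p 0 0 where
  cadlag := fun x => ⟨continuousWithinAt_const, 0, tendsto_const_nhds⟩
  integrable := integrable_zero _ _ _
  integral_eq := by simp
  integral_primV_eq := by simp [primV]

/-- The subspace of `L²_W` formed by the derivatives `D_W^- φ` of the functions `strongFun`. -/
def strongDerivs (p : PeriodicPair) : Submodule ℝ (Lp ℝ 2 p.muW) where
  carrier := {g | ∃ d h, Admissible p d h ∧ g =ᵐ[p.muW] primV p d h}
  add_mem' := by
    rintro a b ⟨d₁, h₁, H₁, e₁⟩ ⟨d₂, h₂, H₂, e₂⟩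
    refine ⟨_, _, H₁.add H₂, ?_⟩
    rw [primV_add _ _ H₁.integrable H₂.integrable]
    exact (Lp.coeFn_add a b).trans (e₁.add e₂)
  zero_mem' := by
    refine ⟨0, 0, admissible_zero, ?_⟩
    filter_upwards [Lp.coeFn_zero ℝ 2 p.muW] with x hx
    rw [hx]; simp [primV]
  smul_mem' := by
    rintro c a ⟨d, h, H, e⟩
    refine ⟨_, _, H.smul c, ?_⟩
    rw [primV_smul]
    exact (Lp.coeFn_smul c a).trans (e.const_smul c)

/-- The normalized indicator of `[a, c)`, an approximation of the Dirac mass of `dV` at `a+`. -/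
def bump (p : PeriodicPair) (a c : ℝ) : ℝ → ℝ :=
  (Ico a c).indicator fun _ => (p.V c - p.V a)⁻¹

lemma isCadlag_bump (a c : ℝ) : IsCadlag (bump p a c) := by
  intro x
  constructor
  · have : bump p a c =ᶠ[𝓝[≥] x] fun _ => bump p a c x := by
      rcases lt_or_ge x a with hxa | hxa
      · filter_upwards [mem_nhdsWithin_of_mem_nhds (Iio_mem_nhds hxa)] with y hy
        simp [bump, hxa.not_ge, (mem_Iio.1 hy).not_ge]
      rcases lt_or_ge x c with hxc | hxc
      · filter_upwards [self_mem_nhdsWithin,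
          mem_nhdsWithin_of_mem_nhds (Iio_mem_nhds hxc)] with y hy hy'
        simp [bump, indicator, hxa, hxc, hxa.trans (mem_Ici.1 hy), mem_Iio.1 hy']
      · filter_upwards [self_mem_nhdsWithin] with y hy
        simp [bump, hxc.not_gt, (hxc.trans (mem_Ici.1 hy)).not_gt]
    exact tendsto_nhds_of_eventually_eq this
  · rcases le_or_gt x a with hxa | hxa
    · refine ⟨0, tendsto_nhds_of_eventually_eq ?_⟩
      filter_upwards [self_mem_nhdsWithin] with y hy
      simp [bump, ((mem_Iio.1 hy).trans_le hxa).not_ge]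
    rcases le_or_gt x c with hxc | hxc
    · refine ⟨(p.V c - p.V a)⁻¹, tendsto_nhds_of_eventually_eq ?_⟩
      filter_upwards [self_mem_nhdsWithin,
          mem_nhdsWithin_of_mem_nhds (Ioi_mem_nhds hxa)] with y hy hy'
      simp [bump, indicator, (mem_Ioi.1 hy').le, (mem_Iio.1 hy).trans_le hxc]
    · refine ⟨0, tendsto_nhds_of_eventually_eq ?_⟩
      filter_upwards [mem_nhdsWithin_of_mem_nhds (Ioi_mem_nhds hxc)] with y hy
      simp [bump, (mem_Ioi.1 hy).le.not_gt]

lemma integrable_bump (a c : ℝ) : Integrable (bump p a c) p.muV :=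
  (integrable_const _).indicator measurableSet_Ico

lemma integral_bump {a c : ℝ} (ha : 0 ≤ a) (hac : a < c) (hc : c ≤ 1) :
    ∫ t, bump p a c t ∂p.muV = 1 := by
  rw [bump, integral_indicator measurableSet_Ico, setIntegral_const,
    p.muV_real_Ico ha hac.le hc, smul_eq_mul]
  exact mul_inv_cancel₀ (sub_pos.2 (p.V_strictMono hac)).ne'

lemma abs_primV_bump_le {a c : ℝ} (ha : 0 ≤ a) (hac : a < c) (hc : c ≤ 1) (s : ℝ) :
    |primV p 0 (bump p a c) s| ≤ 1 := by
  refine (abs_primV_le 0 (integrable_bump a c) s).trans ?_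
  have : ∀ t, |bump p a c t| = bump p a c t := fun t =>
    abs_of_nonneg (indicator_nonneg
      (fun _ _ => inv_nonneg.2 (sub_nonneg.2 (p.V_strictMono.monotone hac.le))) t)
  simp_rw [this]
  rw [integral_bump ha hac hc]; simp

lemma primV_bump_of_le {a c s : ℝ} (hs : s ≤ a) : primV p 0 (bump p a c) s = 0 := by
  rw [primV, zero_add]
  refine setIntegral_eq_zero_of_forall_eq_zero fun t ht => ?_
  simp [bump, (ht.2.trans_le hs).not_ge]

lemma primV_bump_of_ge {a c s : ℝ} (ha : 0 ≤ a) (hac : a < c) (hc : c ≤ 1) (hs : c ≤ s) :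
    primV p 0 (bump p a c) s = 1 := by
  rw [primV, zero_add, ← integral_bump ha hac hc]
  refine setIntegral_eq_integral_of_forall_compl_eq_zero fun t ht => ?_
  refine indicator_of_notMem (fun ht' => ht ⟨ha.trans ht'.1, ht'.2.trans_le hs⟩) _

/-- A function in `L²_W` orthogonal to `strongDerivs` is constant: testing against
primitives of `bump a c - bump b c'` and letting `c ↓ a`, `c' ↓ b` shows that the
integral of its mean-zero part over every half-line vanishes. -/
lemma ae_eq_const_of_mem_orthogonal {k : Lp ℝ 2 p.muW} (hk : k ∈ (strongDerivs p)ᗮ) :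
    ∃ m : ℝ, k =ᵐ[p.muW] fun _ => m := by
  have hkint : Integrable k p.muW := (Lp.memLp k).integrable (by norm_num)
  have hW := p.W_one_pos
  have horth : ∀ d h, Admissible p d h → ∫ s, primV p d h s * k s ∂p.muW = 0 := by
    intro d h H
    have hmem := memLp_primV (q := 2) d H.integrable p.muW
    have := (Submodule.mem_orthogonal _ _).1 hk (hmem.toLp _) ⟨d, h, H, hmem.coeFn_toLp⟩
    rw [L2.inner_def] at this
    rw [← this]
    refine integral_congr_ae ?_
    filter_upwards [hmem.coeFn_toLp] with s hs
    simp [hs, mul_comm]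
  set m : ℝ := (∫ s, k s ∂p.muW) / p.W 1 with hm
  have hk' : Integrable (fun s => k s - m) p.muW := hkint.sub (integrable_const m)
  have htot : ∫ s, (k s - m) ∂p.muW = 0 := by
    rw [integral_sub hkint (integrable_const m), integral_const, p.muW_real_univ, hm, smul_eq_mul]
    field_simp; ring
  have hbdd : ∀ h, Integrable h p.muV → ∀ f, Integrable f p.muW →
      Integrable (fun s => primV p 0 h s * f s) p.muW := fun h hh f hf =>
    hf.mul_of_top_right (memLp_primV 0 hh p.muW)
  -- Once the mean of `k` is subtracted, the test functions need not have mean zero.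
  have horth' : ∀ h, IsCadlag h → Integrable h p.muV → ∫ t, h t ∂p.muV = 0 →
      ∫ s, primV p 0 h s * (k s - m) ∂p.muW = 0 := by
    intro h h1 h2 h3
    set e : ℝ := (∫ s, primV p 0 h s ∂p.muW) / p.W 1 with he
    have hP : Integrable (primV p 0 h) p.muW :=
      (memLp_primV (q := 1) 0 h2 p.muW).integrable le_rfl
    have hd : ∀ s, primV p (-e) h s = primV p 0 h s - e := fun s => by simp only [primV]; ring
    have H : Admissible p (-e) h := by
      refine ⟨h1, h2, h3, ?_⟩
      simp_rw [hd]
      rw [integral_sub hP (integrable_const e), integral_const, p.muW_real_univ, he, smul_eq_mul]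
      field_simp; ring
    have := horth _ _ H
    simp_rw [hd, sub_mul] at this
    rw [integral_sub (hbdd h h2 _ hkint) (hkint.const_mul e), integral_const_mul] at this
    simp_rw [mul_sub]
    rw [integral_sub (hbdd h h2 _ hkint) (hP.mul_const m), integral_mul_const]
    have h5 : (∫ s, primV p 0 h s ∂p.muW) * m = e * ∫ s, k s ∂p.muW := by
      rw [hm, he]; ring
    rw [h5]; exact this
  -- The pairing with the primitive of a bump depends neither on its place nor on its width.
  have hJ : ∀ a b c c', 0 ≤ a → a < c → c ≤ 1 → 0 ≤ b → b < c' → c' ≤ 1 →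
      ∫ s, primV p 0 (bump p a c) s * (k s - m) ∂p.muW =
        ∫ s, primV p 0 (bump p b c') s * (k s - m) ∂p.muW := by
    intro a b c c' ha hac hc hb hbc hc'
    have hi := (integrable_bump (p := p) b c').smul (-1 : ℝ)
    have h1 := horth' (bump p a c + (-1 : ℝ) • bump p b c')
      ((isCadlag_bump a c).add ((isCadlag_bump b c').smul _)) ((integrable_bump a c).add hi) (by
        simp only [Pi.add_apply]
        rw [integral_add (integrable_bump a c) hi]
        simp only [Pi.smul_apply]
        rw [integral_smul, integral_bump ha hac hc, integral_bump hb hbc hc']; simp)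
    have h2 : ∀ s, primV p 0 (bump p a c + (-1 : ℝ) • bump p b c') s =
        primV p 0 (bump p a c) s - primV p 0 (bump p b c') s := by
      intro s
      have e1 := primV_add (p := p) 0 0 (integrable_bump a c) hi
      have e2 := primV_smul (p := p) (-1) 0 (bump p b c')
      rw [mul_zero] at e2
      rw [add_zero, e2] at e1
      rw [e1]
      simp only [Pi.add_apply, Pi.smul_apply, smul_eq_mul]; ring
    simp_rw [h2, sub_mul] at h1
    rw [integral_sub (hbdd _ (integrable_bump a c) _ hk')
      (hbdd _ (integrable_bump b c') _ hk')] at h1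
    linarith
  have hlim : ∀ a, 0 ≤ a → a < 1 →
      Tendsto (fun c => ∫ s, primV p 0 (bump p a c) s * (k s - m) ∂p.muW) (𝓝[>] a)
        (𝓝 (∫ s in Ioi a, (k s - m) ∂p.muW)) := by
    intro a ha ha1
    rw [← integral_indicator measurableSet_Ioi]
    refine tendsto_integral_filter_of_dominated_convergence (fun s => ‖k s - m‖) ?_ ?_ hk'.norm ?_
    · exact Eventually.of_forall fun c =>
        (hbdd _ (integrable_bump a c) _ hk').aestronglyMeasurable
    · filter_upwards [Ioc_mem_nhdsGT ha1] with c hc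
      refine ae_of_all _ fun s => ?_
      rw [norm_mul]
      exact mul_le_of_le_one_left (norm_nonneg _) (abs_primV_bump_le ha hc.1 hc.2 s)
    · refine ae_of_all _ fun s => tendsto_nhds_of_eventually_eq ?_
      rcases le_or_gt s a with hs | hs
      · refine Eventually.of_forall fun c => ?_
        rw [primV_bump_of_le hs, indicator_of_notMem (notMem_Ioi.2 hs), zero_mul]
      · filter_upwards [Ioc_mem_nhdsGT ha1, Ioc_mem_nhdsGT hs] with c hc hc'
        rw [primV_bump_of_ge ha hc.1 hc.2 hc'.2, indicator_of_mem (mem_Ioi.2 hs), one_mul]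
  have hIoi : ∀ b, 0 ≤ b → b < 1 → ∫ s in Ioi b, (k s - m) ∂p.muW = 0 := by
    intro b hb hb1
    have h0 : ∫ s in Ioi 0, (k s - m) ∂p.muW = 0 := by
      rw [Measure.restrict_eq_self_of_ae_mem, htot]
      filter_upwards [p.ae_muW_mem_Ioo] with s hs using hs.1
    have h1 : ∀ a, 0 ≤ a → a < 1 → ∫ s in Ioi a, (k s - m) ∂p.muW =
        ∫ s, primV p 0 (bump p 0 1) s * (k s - m) ∂p.muW := by
      intro a ha ha1
      refine tendsto_nhds_unique (hlim a ha ha1) (tendsto_nhds_of_eventually_eq ?_)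
      filter_upwards [Ioc_mem_nhdsGT ha1] with c hc
      exact hJ a 0 c 1 ha hc.1 hc.2 le_rfl zero_lt_one le_rfl
    rw [h1 b hb hb1, ← h1 0 le_rfl zero_lt_one, h0]
  refine ⟨m, ?_⟩
  have hz := ae_eq_zero_of_forall_setIntegral_Iic_eq_zero hk' htot fun x => ?_
  · filter_upwards [hz] with s hs using sub_eq_zero.1 hs
  have hsum := integral_add_compl (μ := p.muW) (s := Iic x) measurableSet_Iic hk'
  rw [compl_Iic, htot] at hsum
  rcases lt_or_ge x 0 with hx | hx
  · rwa [Measure.restrict_eq_self_of_ae_mem (s := Ioi x), htot, add_zero] at hsum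
    filter_upwards [p.ae_muW_mem_Ioo] with s hs using hx.trans hs.1
  rcases lt_or_ge x 1 with hx1 | hx1
  · rwa [hIoi x hx hx1, add_zero] at hsum
  · rw [Measure.restrict_eq_self_of_ae_mem, htot]
    filter_upwards [p.ae_muW_mem_Ioo] with s hs using hs.2.le.trans hx1

lemma mem_closure_strongDerivs {F : Lp ℝ 2 p.muW} (hF : ∫ s, F s ∂p.muW = 0) :
    F ∈ closure (strongDerivs p : Set (Lp ℝ 2 p.muW)) := by
  rw [← Submodule.topologicalClosure_coe, ← Submodule.orthogonal_orthogonal_eq_closure]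
  refine (Submodule.mem_orthogonal _ _).2 fun k hk => ?_
  obtain ⟨m, hm⟩ := ae_eq_const_of_mem_orthogonal hk
  rw [L2.inner_def]
  calc ∫ s, inner ℝ (k s) (F s) ∂p.muW = ∫ s, m * F s ∂p.muW := by
        refine integral_congr_ae ?_
        filter_upwards [hm] with s hs
        simp [hs, mul_comm]
    _ = 0 := by rw [integral_const_mul, hF, mul_zero]

/-! ### Characterization of the energetic space -/

lemma integral_sq_eq_norm_sq {μ : Measure ℝ} (g : Lp ℝ 2 μ) : ∫ s, g s ^ 2 ∂μ = ‖g‖ ^ 2 := by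
  rw [← real_inner_self_eq_norm_sq, L2.inner_def]
  exact integral_congr_ae (ae_of_all _ fun s => by simp [sq])

lemma setIntegral_eq_inner {S : Set ℝ} (hS : MeasurableSet S) (g : Lp ℝ 2 p.muW) :
    ∫ s in S, g s ∂p.muW = inner ℝ (indicatorConstLp 2 hS (measure_ne_top p.muW S) (1 : ℝ)) g :=
  (L2.inner_indicatorConstLp_one hS _ g).symm

lemma abs_setIntegral_le {S : Set ℝ} (hS : MeasurableSet S) (g : Lp ℝ 2 p.muW) :
    |∫ s in S, g s ∂p.muW| ≤ Real.sqrt (p.W 1) * ‖g‖ := by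
  rw [setIntegral_eq_inner hS]
  refine (abs_real_inner_le_norm _ _).trans (mul_le_mul_of_nonneg_right ?_ (norm_nonneg _))
  rw [norm_indicatorConstLp (by norm_num) (by norm_num), norm_one, one_mul, Real.sqrt_eq_rpow]
  simp only [ENNReal.toReal_ofNat]
  refine Real.rpow_le_rpow measureReal_nonneg ?_ (by norm_num)
  rw [← p.muW_real_univ]
  exact measureReal_mono (subset_univ _)

lemma abs_primW_zero_le (g : Lp ℝ 2 p.muW) (x : ℝ) :
    |primW p 0 g x| ≤ Real.sqrt (p.W 1) * ‖g‖ := by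
  rw [primW, zero_add]; exact abs_setIntegral_le measurableSet_Ioc g

lemma integrable_Lp (g : Lp ℝ 2 p.muW) : Integrable g p.muW :=
  (Lp.memLp g).integrable (by norm_num)

lemma primW_sub_primW {F G : ℝ → ℝ} (c : ℝ) (hF : Integrable F p.muW) (hG : Integrable G p.muW)
    (x : ℝ) : primW p c F x - primW p c G x = primW p 0 (F - G) x := by
  simp only [primW, Pi.sub_apply]
  rw [integral_sub hF.integrableOn hG.integrableOn]; ring

/-- Every function with a weak derivative in `L²_W` belongs to the energetic space. -/
theorem HasWeakDeriv.memH {f F : ℝ → ℝ} {c : ℝ} (h : HasWeakDeriv p f c F) : MemH p f := by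
  have hfLp : MemLp f 2 p.muV := (memLp_congr_ae h.2.2).2 (memLp_primW c h.integrable p.muV)
  set F' : Lp ℝ 2 p.muW := h.1.toLp F with hF'
  have hF'ae : F' =ᵐ[p.muW] F := h.1.coeFn_toLp
  obtain ⟨g, hg, hlim⟩ := mem_closure_iff_seq_limit.1
    (mem_closure_strongDerivs (F := F') (by rw [integral_congr_ae hF'ae]; exact h.2.1))
  choose d k H hgk using hg
  have hcoe : ∀ n x, strongFun p c (d n) (k n) x = primW p c (g n) (Int.fract x) := fun n x => by
    rw [strongFun, primW_congr c (hgk n)]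
  refine ⟨hfLp, fun n => strongFun p c (d n) (k n), fun n => (H n).strongDomain c, ?_, ?_⟩
  · have hbound : ∀ n, eLpNorm (strongFun p c (d n) (k n) - f) 2 p.muV ≤
        p.muV univ ^ (ENNReal.toReal 2)⁻¹ * ENNReal.ofReal (Real.sqrt (p.W 1) * ‖g n - F'‖) := by
      intro n
      refine eLpNorm_le_of_ae_bound ?_
      filter_upwards [h.2.2, p.ae_muV_mem_Ico] with x hx hx'
      have e1 : f x = primW p c F' x := by rw [hx, primW_congr c hF'ae]; rfl
      rw [Pi.sub_apply, hcoe, Int.fract_eq_self.2 hx', e1,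
        primW_sub_primW c (integrable_Lp _) (integrable_Lp _),
        ← primW_congr 0 (Lp.coeFn_sub (g n) F')]
      exact abs_primW_zero_le _ x
    refine tendsto_of_tendsto_of_tendsto_of_le_of_le tendsto_const_nhds ?_
      (fun _ => zero_le) hbound
    have h0 : Tendsto (fun n => ‖g n - F'‖) atTop (𝓝 0) := tendsto_iff_norm_sub_tendsto_zero.1 hlim
    have h1 := ENNReal.tendsto_ofReal (h0.const_mul (Real.sqrt (p.W 1)))
    rw [mul_zero, ENNReal.ofReal_zero] at h1
    have h2 := ENNReal.Tendsto.const_mul (a := p.muV univ ^ (ENNReal.toReal 2)⁻¹) h1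
      (Or.inr (ENNReal.rpow_ne_top_of_nonneg (by positivity) (measure_ne_top _ _)))
    rwa [mul_zero] at h2
  · intro ε hε
    -- The constant from `‖primW p 0 G‖_V² ≤ W(1) V(1) ‖G‖_W²`, plus one for the Dirichlet part.
    set C : ℝ := p.W 1 * p.V 1 + 1 with hC
    have hV : 0 < p.V 1 := by
      have := p.V_strictMono zero_lt_one; rwa [p.V_zero] at this
    have hCpos : 0 < C := by have := p.W_one_pos; positivity
    have hE : ∀ m n, energySq p (strongFun p c (d m) (k m) - strongFun p c (d n) (k n)) ≤
        C * ‖g m - g n‖ ^ 2 := by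
      intro m n
      set D := d m + (-1) * d n
      set K := k m + (-1 : ℝ) • k n
      have HA : Admissible p D K := (H m).add ((H n).smul (-1))
      have hGK : (g m - g n : Lp ℝ 2 p.muW) =ᵐ[p.muW] primV p D K := by
        rw [primV_add _ _ (H m).integrable ((H n).integrable.smul (-1 : ℝ)), primV_smul]
        filter_upwards [Lp.coeFn_sub (g m) (g n), hgk m, hgk n] with s h1 h2 h3
        rw [h1]
        simp only [Pi.sub_apply, Pi.add_apply, Pi.smul_apply, smul_eq_mul, h2, h3]; ring
      have e1 : strongFun p c (d m) (k m) - strongFun p c (d n) (k n) = strongFun p 0 D K := by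
        ext x
        rw [Pi.sub_apply, hcoe, hcoe, primW_sub_primW c (integrable_Lp _) (integrable_Lp _),
          ← primW_congr 0 (Lp.coeFn_sub (g m) (g n)), primW_congr 0 hGK, strongFun]
      rw [e1, HA.energySq_strongFun, ← primW_congr 0 hGK,
        ← integral_congr_ae (hGK.mono fun s hs => by simp only [hs] :
          (fun s => (g m - g n : Lp ℝ 2 p.muW) s ^ 2) =ᵐ[p.muW] fun s => primV p D K s ^ 2),
        integral_sq_eq_norm_sq]
      have h2 : ∫ x, primW p 0 (g m - g n : Lp ℝ 2 p.muW) x ^ 2 ∂p.muV ≤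
          ∫ _, p.W 1 * ‖g m - g n‖ ^ 2 ∂p.muV := by
        refine integral_mono (memLp_primW 0 (integrable_Lp _) p.muV).integrable_sq
          (integrable_const _) fun x => ?_
        have := sq_le_sq' (abs_le.1 (abs_primW_zero_le (g m - g n) x)).1
          (abs_le.1 (abs_primW_zero_le (g m - g n) x)).2
        rwa [mul_pow, Real.sq_sqrt p.W_one_pos.le] at this
      rw [integral_const, p.muV_real_univ, smul_eq_mul] at h2
      rw [hC]; linarith
    obtain ⟨N, hN⟩ := Metric.cauchySeq_iff.1 hlim.cauchySeq (Real.sqrt (ε / C))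
      (Real.sqrt_pos.2 (div_pos hε hCpos))
    refine ⟨N, fun m hm n hn => (hE m n).trans_lt ?_⟩
    have h1 := hN m hm n hn
    rw [dist_eq_norm] at h1
    have h2 := pow_lt_pow_left₀ h1 (norm_nonneg _) two_ne_zero
    rw [Real.sq_sqrt (div_pos hε hCpos).le, lt_div_iff₀ hCpos] at h2
    linarith

lemma memHD_iff {f : ℝ → ℝ} : MemHD p f ↔ ∃ F, HasWeakDeriv p f 0 F :=
  ⟨fun h => h.2, fun ⟨F, hF⟩ => ⟨hF.memH, F, hF⟩⟩

lemma MemHD.hasWeakDeriv {f : ℝ → ℝ} (h : MemHD p f) : HasWeakDeriv p f 0 (weakDeriv p f) :=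
  let ⟨_, hF⟩ := h.2; hF.weakDeriv.1

variable {κ H : ℝ → ℝ}

/-! ### The variational problem in the space of weak derivatives -/

/-- Measurability and boundedness of the coefficients and ellipticity of the second-order part,
which gives coercivity in the Dirichlet norm. -/
structure IsElliptic (p : PeriodicPair) (κ H : ℝ → ℝ) : Prop where
  aemeasurable_κ : AEMeasurable κ p.muV
  aemeasurable_H : AEMeasurable H p.muW
  bdd_κ : ∃ K : ℝ, ∀ x, |κ x| ≤ K
  bdd_H : ∃ K : ℝ, ∀ x, |H x| ≤ K
  lower_H : ∃ H₀ : ℝ, 0 < H₀ ∧ ∀ x, H₀ ≤ H x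

/-- The bilinear form of the equation in terms of the weak derivatives. -/
def derivForm (p : PeriodicPair) (κ H : ℝ → ℝ) (F G : ℝ → ℝ) : ℝ :=
  ∫ x, κ x ^ 2 * primW p 0 F x * primW p 0 G x ∂p.muV + ∫ s, H s * F s * G s ∂p.muW

lemma derivForm_comm (F G : ℝ → ℝ) : derivForm p κ H F G = derivForm p κ H G F := by
  simp only [derivForm, mul_right_comm]

lemma bilinearForm_eq_derivForm {f g F G : ℝ → ℝ} (hf : HasWeakDeriv p f 0 F)
    (hg : HasWeakDeriv p g 0 G) : bilinearForm p κ H f g = derivForm p κ H F G := by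
  rw [bilinearForm, derivForm]
  congr 1
  · refine integral_congr_ae ?_
    filter_upwards [hf.2.2, hg.2.2] with x h1 h2
    rw [h1, h2]; rfl
  · refine integral_congr_ae ?_
    filter_upwards [hf.weakDeriv.2, hg.weakDeriv.2] with s h1 h2
    rw [h1, h2]

lemma primW_add (F G : Lp ℝ 2 p.muW) :
    primW p 0 (F + G : Lp ℝ 2 p.muW) = primW p 0 F + primW p 0 G := by
  rw [primW_congr 0 (Lp.coeFn_add F G)]
  ext x
  simp only [primW, Pi.add_apply]
  rw [integral_add (integrable_Lp F).integrableOn (integrable_Lp G).integrableOn]; ring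

lemma primW_smul (a : ℝ) (F : Lp ℝ 2 p.muW) :
    primW p 0 (a • F : Lp ℝ 2 p.muW) = a • primW p 0 F := by
  rw [primW_congr 0 (Lp.coeFn_smul a F)]
  ext x
  simp only [primW, Pi.smul_apply, smul_eq_mul]
  rw [integral_const_mul]; ring

namespace IsElliptic

lemma integrable_zeroth (h : IsElliptic p κ H) (F G : Lp ℝ 2 p.muW) :
    Integrable (fun x => κ x ^ 2 * primW p 0 F x * primW p 0 G x) p.muV := by
  have hκ : MemLp (fun x => κ x ^ 2) ⊤ p.muV := by
    obtain ⟨K, hK⟩ := h.bdd_κ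
    refine MemLp.of_bound (h.aemeasurable_κ.pow_const 2).aestronglyMeasurable (K ^ 2)
      (ae_of_all _ fun x => ?_)
    rw [Real.norm_eq_abs, abs_pow]
    exact pow_le_pow_left₀ (abs_nonneg _) (hK x) 2
  have h2 : Integrable (fun x => κ x ^ 2 * primW p 0 F x) p.muV :=
    ((memLp_primW (q := 1) 0 (integrable_Lp F) p.muV).integrable le_rfl).mul_of_top_right hκ
  exact h2.mul_of_top_left (memLp_primW 0 (integrable_Lp G) p.muV)

lemma integrable_second (h : IsElliptic p κ H) (F G : Lp ℝ 2 p.muW) :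
    Integrable (fun s => H s * F s * G s) p.muW := by
  have hH : MemLp H ⊤ p.muW := by
    obtain ⟨K, hK⟩ := h.bdd_H
    exact MemLp.of_bound h.aemeasurable_H.aestronglyMeasurable K (ae_of_all _ hK)
  have h1 : Integrable (fun s => F s * G s) p.muW := (Lp.memLp F).integrable_mul (Lp.memLp G)
  simp_rw [mul_assoc]
  exact h1.mul_of_top_right hH

lemma derivForm_add (h : IsElliptic p κ H) (F F' G : Lp ℝ 2 p.muW) :
    derivForm p κ H (F + F' : Lp ℝ 2 p.muW) G = derivForm p κ H F G + derivForm p κ H F' G := by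
  have e1 : ∀ x, κ x ^ 2 * primW p 0 (F + F' : Lp ℝ 2 p.muW) x * primW p 0 G x =
      κ x ^ 2 * primW p 0 F x * primW p 0 G x + κ x ^ 2 * primW p 0 F' x * primW p 0 G x := by
    intro x; rw [primW_add, Pi.add_apply]; ring
  have e2 : ∫ s, H s * (F + F' : Lp ℝ 2 p.muW) s * G s ∂p.muW =
      ∫ s, (H s * F s * G s + H s * F' s * G s) ∂p.muW := by
    refine integral_congr_ae ?_
    filter_upwards [Lp.coeFn_add F F'] with s hs
    rw [hs, Pi.add_apply]; ring
  rw [derivForm, derivForm, derivForm, e2]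
  simp_rw [e1]
  rw [integral_add (h.integrable_zeroth F G) (h.integrable_zeroth F' G),
    integral_add (h.integrable_second F G) (h.integrable_second F' G)]
  ring

lemma derivForm_smul (a : ℝ) (F G : Lp ℝ 2 p.muW) :
    derivForm p κ H (a • F : Lp ℝ 2 p.muW) G = a * derivForm p κ H F G := by
  have e1 : ∀ x, κ x ^ 2 * primW p 0 (a • F : Lp ℝ 2 p.muW) x * primW p 0 G x =
      a * (κ x ^ 2 * primW p 0 F x * primW p 0 G x) := by
    intro x; rw [primW_smul, Pi.smul_apply, smul_eq_mul]; ring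
  have e2 : ∫ s, H s * (a • F : Lp ℝ 2 p.muW) s * G s ∂p.muW =
      ∫ s, a * (H s * F s * G s) ∂p.muW := by
    refine integral_congr_ae ?_
    filter_upwards [Lp.coeFn_smul a F] with s hs
    rw [hs, Pi.smul_apply, smul_eq_mul]; ring
  rw [derivForm, derivForm, e2]
  simp_rw [e1]
  rw [integral_const_mul, integral_const_mul]
  ring

lemma exists_bound (h : IsElliptic p κ H) :
    ∃ C : ℝ, ∀ F G : Lp ℝ 2 p.muW, ‖derivForm p κ H F G‖ ≤ C * ‖F‖ * ‖G‖ := by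
  obtain ⟨K, hK⟩ := h.bdd_κ
  obtain ⟨L, hL⟩ := h.bdd_H
  refine ⟨K ^ 2 * p.W 1 * p.V 1 + L, fun F G => ?_⟩
  have h1 : ‖∫ x, κ x ^ 2 * primW p 0 F x * primW p 0 G x ∂p.muV‖ ≤
      (K ^ 2 * (Real.sqrt (p.W 1) * ‖F‖) * (Real.sqrt (p.W 1) * ‖G‖)) * p.muV.real univ := by
    refine norm_integral_le_of_norm_le_const (ae_of_all _ fun x => ?_)
    rw [norm_mul, norm_mul, norm_pow]
    have := hK x
    gcongr
    · exact this
    · exact abs_primW_zero_le F x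
    · exact abs_primW_zero_le G x
  have h2 : ‖∫ s, H s * F s * G s ∂p.muW‖ ≤ L * (‖F‖ * ‖G‖) := by
    have h3 : ∫ s, L * (|F| s * |G| s) ∂p.muW = L * inner ℝ |F| |G| := by
      rw [integral_const_mul, L2.inner_def]
      simp [mul_comm]
    have hL0 : 0 ≤ L := (abs_nonneg _).trans (hL 0)
    refine (norm_integral_le_of_norm_le (g := fun s => L * (|F| s * |G| s)) ?_ ?_).trans ?_
    · exact ((Lp.memLp |F|).integrable_mul (Lp.memLp |G|)).const_mul L
    · filter_upwards [Lp.coeFn_abs F, Lp.coeFn_abs G] with s hF hG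
      rw [hF, hG, norm_mul, norm_mul, Real.norm_eq_abs, Real.norm_eq_abs, Real.norm_eq_abs,
        mul_assoc]
      exact mul_le_mul_of_nonneg_right (hL s) (by positivity)
    · rw [h3]
      refine mul_le_mul_of_nonneg_left ((real_inner_le_norm _ _).trans ?_) hL0
      rw [norm_abs_eq_norm, norm_abs_eq_norm]
  rw [p.muV_real_univ] at h1
  refine (norm_add_le _ _).trans ((add_le_add h1 h2).trans (le_of_eq ?_))
  have := Real.mul_self_sqrt p.W_one_pos.le
  linear_combination (K ^ 2 * ‖F‖ * ‖G‖ * p.V 1) * this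

lemma coercive_bound (h : IsElliptic p κ H) {H₀ : ℝ} (hH₀ : ∀ x, H₀ ≤ H x) (F : Lp ℝ 2 p.muW) :
    H₀ * ‖F‖ * ‖F‖ ≤ derivForm p κ H F F := by
  have h1 : 0 ≤ ∫ x, κ x ^ 2 * primW p 0 F x * primW p 0 F x ∂p.muV :=
    integral_nonneg fun x => by
      change 0 ≤ κ x ^ 2 * primW p 0 F x * primW p 0 F x
      rw [mul_assoc]; exact mul_nonneg (sq_nonneg _) (mul_self_nonneg _)
  have h2 : ∫ s, H₀ * F s ^ 2 ∂p.muW ≤ ∫ s, H s * F s * F s ∂p.muW :=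
    integral_mono ((Lp.memLp F).integrable_sq.const_mul H₀) (h.integrable_second F F) fun s => by
      change H₀ * F s ^ 2 ≤ H s * F s * F s
      nlinarith [mul_le_mul_of_nonneg_right (hH₀ s) (sq_nonneg (F s))]
  rw [integral_const_mul, integral_sq_eq_norm_sq] at h2
  rw [derivForm]
  nlinarith

end IsElliptic

/-- The Hilbert space of weak derivatives of elements of `H_{W,V,𝒟}(𝕋)`: the mean-zero elements of
`L²_W(𝕋)`. -/
def meanZero (p : PeriodicPair) : Submodule ℝ (Lp ℝ 2 p.muW) :=
  (Submodule.span ℝ {indicatorConstLp 2 MeasurableSet.univ (measure_ne_top p.muW univ) (1 : ℝ)})ᗮ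

instance : CompleteSpace (meanZero p) := by unfold meanZero; infer_instance

lemma mem_meanZero {g : Lp ℝ 2 p.muW} : g ∈ meanZero p ↔ ∫ s, g s ∂p.muW = 0 := by
  rw [meanZero, Submodule.mem_orthogonal_singleton_iff_inner_right, ← setIntegral_eq_inner,
    Measure.restrict_univ]

lemma hasWeakDeriv_primW (F : meanZero p) :
    HasWeakDeriv p (primW p 0 (F : Lp ℝ 2 p.muW)) 0 (F : Lp ℝ 2 p.muW) :=
  ⟨Lp.memLp _, mem_meanZero.1 F.2, EventuallyEq.rfl⟩

lemma HasWeakDeriv.congr {f g F : ℝ → ℝ} {c : ℝ} (h : HasWeakDeriv p f c F)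
    (hfg : g =ᵐ[p.muV] f) : HasWeakDeriv p g c F :=
  ⟨h.1, h.2.1, hfg.trans h.2.2⟩

lemma comp_fract_ae_eq (f : ℝ → ℝ) : (fun x => f (Int.fract x)) =ᵐ[p.muV] f := by
  filter_upwards [p.ae_muV_mem_Ico] with x hx
  rw [Int.fract_eq_self.2 hx]

/-- The weak derivative of an element of `H_{W,V,𝒟}(𝕋)` as an element of the Hilbert space. -/
def derivClass {g : ℝ → ℝ} (hg : MemHD p g) : meanZero p :=
  ⟨hg.hasWeakDeriv.1.toLp (weakDeriv p g), mem_meanZero.2 <| by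
    rw [integral_congr_ae hg.hasWeakDeriv.1.coeFn_toLp]; exact hg.hasWeakDeriv.2.1⟩

lemma coeFn_derivClass {g : ℝ → ℝ} (hg : MemHD p g) :
    (derivClass hg : Lp ℝ 2 p.muW) =ᵐ[p.muW] weakDeriv p g :=
  hg.hasWeakDeriv.1.coeFn_toLp

lemma dirichletNorm_eq {g : ℝ → ℝ} (hg : MemHD p g) : dirichletNorm p g = ‖derivClass hg‖ := by
  have : ∫ s, weakDeriv p g s ^ 2 ∂p.muW =
      ∫ s, (derivClass hg : Lp ℝ 2 p.muW) s ^ 2 ∂p.muW :=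
    integral_congr_ae ((coeFn_derivClass hg).mono fun s hs => by simp only [hs])
  rw [dirichletNorm, this, integral_sq_eq_norm_sq, Real.sqrt_sq (norm_nonneg _)]
  rfl

namespace IsElliptic

/-- The form of the equation as a bounded bilinear form on `meanZero p`. -/
def form (h : IsElliptic p κ H) : meanZero p →L[ℝ] meanZero p →L[ℝ] ℝ :=
  LinearMap.mkContinuousOfExistsBound₂
    (LinearMap.mk₂ ℝ (fun F G : meanZero p =>
        derivForm p κ H (F : Lp ℝ 2 p.muW) (G : Lp ℝ 2 p.muW))
      (fun F F' G => h.derivForm_add _ _ _) (fun a F G => derivForm_smul _ _ _)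
      (fun F G G' => by
        simp only [derivForm_comm (F := (F : Lp ℝ 2 p.muW))]; exact h.derivForm_add _ _ _)
      (fun a F G => by
        simp only [derivForm_comm (F := (F : Lp ℝ 2 p.muW))]; exact derivForm_smul _ _ _))
    (let ⟨C, hC⟩ := h.exists_bound; ⟨C, fun F G => hC F G⟩)

lemma form_apply (h : IsElliptic p κ H) (F G : meanZero p) :
    h.form F G = derivForm p κ H (F : Lp ℝ 2 p.muW) (G : Lp ℝ 2 p.muW) := rfl

lemma isCoercive_form (h : IsElliptic p κ H) : IsCoercive h.form := by
  obtain ⟨H₀, hpos, hH₀⟩ := h.lower_H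
  exact ⟨H₀, hpos, fun F => h.coercive_bound hH₀ F⟩

/-- The element of `meanZero p` that represents `G ↦ ∫ b G dW` with respect to the form of the
equation. -/
def resolvent (h : IsElliptic p κ H) (b : Lp ℝ 2 p.muW) : meanZero p :=
  h.isCoercive_form.continuousLinearEquivOfBilin.symm
    (ContinuousLinearMap.adjoint (meanZero p).subtypeL b)

lemma form_resolvent (h : IsElliptic p κ H) (b : Lp ℝ 2 p.muW) (G : meanZero p) :
    h.form (h.resolvent b) G = inner ℝ b (G : Lp ℝ 2 p.muW) := by
  rw [← h.isCoercive_form.continuousLinearEquivOfBilin_apply, resolvent,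
    ContinuousLinearEquiv.apply_symm_apply, ContinuousLinearMap.adjoint_inner_left]
  rfl

lemma eq_resolvent (h : IsElliptic p κ H) {b : Lp ℝ 2 p.muW} {F : meanZero p}
    (hF : ∀ G : meanZero p, h.form F G = inner ℝ b (G : Lp ℝ 2 p.muW)) : F = h.resolvent b := by
  refine h.isCoercive_form.continuousLinearEquivOfBilin.injective (ext_inner_right ℝ fun G => ?_)
  rw [IsCoercive.continuousLinearEquivOfBilin_apply, IsCoercive.continuousLinearEquivOfBilin_apply,
    hF, h.form_resolvent]

/-- The derivative of the Green function: it represents the evaluation at `x` of the primitive with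
respect to the form of the equation. -/
def green (h : IsElliptic p κ H) (x : ℝ) : meanZero p :=
  h.resolvent (indicatorConstLp 2 measurableSet_Ioc (measure_ne_top p.muW (Ioc 0 x)) (1 : ℝ))

/-- The form being symmetric, the solution at `x` is the pairing of the datum with a fixed
element of `L²_W`. -/
lemma primW_resolvent (h : IsElliptic p κ H) (b : Lp ℝ 2 p.muW) (x : ℝ) :
    primW p 0 (h.resolvent b : Lp ℝ 2 p.muW) x = inner ℝ b (h.green x : Lp ℝ 2 p.muW) := by
  rw [primW, zero_add, setIntegral_eq_inner measurableSet_Ioc, ← h.form_resolvent b,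
    form_apply, derivForm_comm, ← h.form_apply, green, h.form_resolvent]

end IsElliptic

/-! ### The pathwise equation -/

section Pathwise

variable {b : ℝ → ℝ} {β : Lp ℝ 2 p.muW}

lemma integrable_noiseIntegrand (hβ : β =ᵐ[p.muW] Function.leftLim b) {g : ℝ → ℝ}
    (hg : MemHD p g) : Integrable (noiseIntegrand p b g) p.muW :=
  ((memLp_congr_ae hβ).1 (Lp.memLp β)).integrable_mul hg.hasWeakDeriv.1

lemma whiteNoise_eq (hβ : β =ᵐ[p.muW] Function.leftLim b) {g : ℝ → ℝ} {G : Lp ℝ 2 p.muW}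
    (hG : HasWeakDeriv p g 0 G) : whiteNoise p b g = inner ℝ (-β) G := by
  rw [inner_neg_left, whiteNoise, L2.inner_def, neg_inj]
  refine integral_congr_ae ?_
  filter_upwards [hβ, hG.weakDeriv.2] with s h1 h2
  rw [noiseIntegrand, ← h1, h2]
  simp [mul_comm]

lemma MemHD.hasWeakDeriv_derivClass {g : ℝ → ℝ} (hg : MemHD p g) :
    HasWeakDeriv p g 0 (derivClass hg : Lp ℝ 2 p.muW) := by
  refine ⟨Lp.memLp _, mem_meanZero.1 (derivClass hg).2, ?_⟩
  exact hg.hasWeakDeriv.2.2.trans (Eq.eventuallyEq (primW_congr 0 (coeFn_derivClass hg)).symm)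

lemma HasWeakDeriv.lin_comb {g₁ g₂ : ℝ → ℝ} {G₁ G₂ : Lp ℝ 2 p.muW}
    (h₁ : HasWeakDeriv p g₁ 0 G₁) (h₂ : HasWeakDeriv p g₂ 0 G₂) (a c : ℝ) :
    HasWeakDeriv p (a • g₁ + c • g₂) 0 (a • G₁ + c • G₂ : Lp ℝ 2 p.muW) := by
  refine ⟨Lp.memLp _, mem_meanZero.1 ((meanZero p).add_mem
    ((meanZero p).smul_mem a (mem_meanZero.2 h₁.2.1))
    ((meanZero p).smul_mem c (mem_meanZero.2 h₂.2.1))), ?_⟩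
  change _ =ᵐ[p.muV] primW p 0 _
  rw [primW_add, primW_smul, primW_smul]
  exact (h₁.2.2.const_smul a).add (h₂.2.2.const_smul c)

lemma memDualHD_whiteNoise (hβ : β =ᵐ[p.muW] Function.leftLim b) :
    MemDualHD p (whiteNoise p b) := by
  refine ⟨fun g₁ g₂ h₁ h₂ a c => ?_, ‖β‖, fun g hg => ?_⟩
  · rw [whiteNoise_eq hβ h₁.hasWeakDeriv_derivClass, whiteNoise_eq hβ h₂.hasWeakDeriv_derivClass,
      whiteNoise_eq hβ (h₁.hasWeakDeriv_derivClass.lin_comb h₂.hasWeakDeriv_derivClass a c),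
      inner_add_right, inner_smul_right, inner_smul_right]
  · rw [whiteNoise_eq hβ hg.hasWeakDeriv_derivClass, dirichletNorm_eq hg, ← norm_neg β]
    exact abs_real_inner_le_norm _ _

lemma isWeakSolution_of_hasWeakDeriv_resolvent (h : IsElliptic p κ H)
    (hβ : β =ᵐ[p.muW] Function.leftLim b) {u : ℝ → ℝ}
    (hu : HasWeakDeriv p u 0 (h.resolvent (-β) : Lp ℝ 2 p.muW)) :
    IsWeakSolution p κ H (whiteNoise p b) u := by
  refine ⟨memHD_iff.2 ⟨_, hu⟩, fun g hg => ?_⟩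
  rw [bilinearForm_eq_derivForm hu hg.hasWeakDeriv_derivClass, ← h.form_apply, h.form_resolvent,
    whiteNoise_eq hβ hg.hasWeakDeriv_derivClass]

lemma IsWeakSolution.ae_eq (h : IsElliptic p κ H) (hβ : β =ᵐ[p.muW] Function.leftLim b)
    {v : ℝ → ℝ} (hv : IsWeakSolution p κ H (whiteNoise p b) v) :
    v =ᵐ[p.muV] primW p 0 (h.resolvent (-β) : Lp ℝ 2 p.muW) := by
  have hF : derivClass hv.1 = h.resolvent (-β) := by
    refine h.eq_resolvent fun G => ?_
    have hG := hasWeakDeriv_primW G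
    rw [h.form_apply, ← bilinearForm_eq_derivForm hv.1.hasWeakDeriv_derivClass hG,
      hv.2 _ (memHD_iff.2 ⟨_, hG⟩), whiteNoise_eq hβ hG]
  rw [← hF]
  exact hv.1.hasWeakDeriv_derivClass.2.2

end Pathwise

/-! ### Càdlàg paths -/

lemma IsCadlagOn.exists_bound {b : ℝ → ℝ} (hb : IsCadlagOn b (Icc 0 1)) :
    ∃ C : ℝ, ∀ s ∈ Icc (0 : ℝ) 1, |b s| ≤ C := by
  refine isCompact_Icc.induction_on (p := fun S => ∃ C : ℝ, ∀ s ∈ S, |b s| ≤ C) ⟨0, by simp⟩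
    (fun S T hST ⟨C, hC⟩ => ⟨C, fun s hs => hC s (hST hs)⟩)
    (fun S T ⟨C, hC⟩ ⟨D, hD⟩ => ⟨max C D, fun s hs => hs.elim
      (fun h => (hC s h).trans (le_max_left _ _)) fun h => (hD s h).trans (le_max_right _ _)⟩)
    fun x hx => ?_
  obtain ⟨h1, l, h2⟩ := hb x hx
  refine ⟨{s | |b s| ≤ max (|b x| + 1) (|l| + 1)}, ?_, max (|b x| + 1) (|l| + 1), fun s hs => hs⟩
  have hsplit : Icc (0 : ℝ) 1 = (Icc 0 1 ∩ Ici x) ∪ (Icc 0 1 ∩ Iio x) := by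
    rw [← inter_union_distrib_left, union_comm, Iio_union_Ici, inter_univ]
  rw [hsplit, nhdsWithin_union]
  refine ⟨?_, ?_⟩
  · filter_upwards [h1.abs.eventually_lt_const (lt_add_one _)] with s hs
    exact hs.le.trans (le_max_left _ _)
  · filter_upwards [h2.abs.eventually_lt_const (lt_add_one _)] with s hs
    exact hs.le.trans (le_max_right _ _)

lemma IsCadlagOn.tendsto_leftLim {b : ℝ → ℝ} (hb : IsCadlagOn b (Icc 0 1)) {s : ℝ}
    (hs : s ∈ Ioo 0 1) : Tendsto b (𝓝[<] s) (𝓝 (Function.leftLim b s)) := by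
  obtain ⟨l, hl⟩ := (hb s (Ioo_subset_Icc_self hs)).2
  rw [nhdsWithin_inter_of_mem (mem_nhdsWithin_of_mem_nhds (Icc_mem_nhds hs.1 hs.2))] at hl
  rwa [leftLim_eq_of_tendsto hl]

/-- The left limits of a family of paths on `[0, 1]`, taken along the grids `leftGrid n` so as to be
jointly measurable in the time and the parameter. The projection to `[0, 1]` avoids the times at
which the family need not be measurable. -/
def leftPath {Ω : Type*} (B : ℝ → Ω → ℝ) (q : ℝ × Ω) : ℝ :=
  limUnder atTop fun n => B (projIcc (0 : ℝ) 1 zero_le_one (leftGrid n q.1)) q.2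

lemma measurable_leftPath {Ω : Type*} [MeasurableSpace Ω] {B : ℝ → Ω → ℝ}
    (hB : ∀ t ∈ Icc (0 : ℝ) 1, Measurable (B t)) : StronglyMeasurable (leftPath B) := by
  refine StronglyMeasurable.limUnder fun n => Measurable.stronglyMeasurable ?_
  have hr : ∀ r : ℝ, Measurable (B (projIcc (0 : ℝ) 1 zero_le_one r)) := fun r =>
    hB _ (Subtype.prop _)
  have h1 : Measurable fun q : ℤ × Ω =>
      B (projIcc (0 : ℝ) 1 zero_le_one (((q.1 : ℝ) - 1) / ((n : ℝ) + 1))) q.2 :=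
    measurable_from_prod_countable_right fun k => hr (((k : ℝ) - 1) / ((n : ℝ) + 1))
  have h2 : Measurable fun q : ℝ × Ω => (⌈((n : ℝ) + 1) * q.1⌉, q.2) :=
    (Int.measurable_ceil.comp (measurable_fst.const_mul _)).prodMk measurable_snd
  have h3 := h1.comp h2
  simp only [Function.comp_def] at h3
  simpa only [leftGrid] using h3

lemma leftPath_eq {Ω : Type*} {B : ℝ → Ω → ℝ} {ω : Ω} (hb : IsCadlagOn (fun t => B t ω) (Icc 0 1))
    {s : ℝ} (hs : s ∈ Ioo 0 1) : leftPath B (s, ω) = Function.leftLim (fun t => B t ω) s := by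
  refine Tendsto.limUnder_eq (((hb.tendsto_leftLim hs).comp (tendsto_leftGrid s)).congr' ?_)
  filter_upwards [(tendsto_leftGrid s).eventually (Ioo_mem_nhdsLT hs.1)] with n hn
  rw [projIcc_of_mem _ ⟨hn.1.le, hn.2.le.trans hs.2.le⟩]
  rfl

/-- Values of the path outside `[0, 1]` affect its left limits on `[0, 1)` only at `0`, which is
not an atom of `dW`. -/
lemma memLp_leftLim {Ω : Type*} [MeasurableSpace Ω] {B : ℝ → Ω → ℝ}
    (hB : ∀ t ∈ Icc (0 : ℝ) 1, Measurable (B t)) {ω : Ω}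
    (hb : IsCadlagOn (fun t => B t ω) (Icc 0 1)) :
    MemLp (Function.leftLim fun t => B t ω) 2 p.muW := by
  have hae : (fun s => leftPath B (s, ω)) =ᵐ[p.muW] Function.leftLim fun t => B t ω := by
    filter_upwards [p.ae_muW_mem_Ioo] with s hs using leftPath_eq hb hs
  obtain ⟨C, hC⟩ := hb.exists_bound
  refine MemLp.of_bound (AEStronglyMeasurable.congr
    ((measurable_leftPath hB).comp_measurable measurable_prodMk_right).aestronglyMeasurable hae)
    C ?_
  filter_upwards [p.ae_muW_mem_Ioo] with s hs
  refine le_of_tendsto (hb.tendsto_leftLim hs).norm ?_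
  filter_upwards [Ioo_mem_nhdsLT hs.1] with t ht
  exact hC t ⟨ht.1.le, ht.2.le.trans hs.2.le⟩

end WVSobolev

end

theorem theorem8p1 {Ω : Type*} [MeasurableSpace Ω] (P : Measure Ω) [IsProbabilityMeasure P]
    (p : WVSobolev.PeriodicPair)
    (B : ℝ → Ω → ℝ) (hB : WVSobolev.IsWBrownianMotion p.W P B)
    (κ H : ℝ → ℝ) (hκ_per : Function.Periodic κ 1) (hH_per : Function.Periodic H 1)
    (hκ_meas : AEMeasurable κ p.muV) (hH_meas : AEMeasurable H p.muW)
    (hκ_bdd : ∃ K : ℝ, ∀ x, |κ x| ≤ K) (hκ_away : ∃ κ₀ : ℝ, 0 < κ₀ ∧ ∀ x, κ₀ ≤ |κ x|)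
    (hH_bdd : ∃ K : ℝ, ∀ x, H x ≤ K) (hH_away : ∃ H₀ : ℝ, 0 < H₀ ∧ ∀ x, H₀ ≤ H x) :
    ∃ u : ℝ → Ω → ℝ, (∀ x, Measurable (u x)) ∧
      ∀ᵐ ω ∂P,
        -- the white noise is pathwise well defined and belongs to the dual space
        (∀ g : ℝ → ℝ, WVSobolev.MemHD p g →
          Integrable (WVSobolev.noiseIntegrand p (fun t => B t ω) g) p.muW) ∧
        WVSobolev.MemDualHD p (WVSobolev.whiteNoise p (fun t => B t ω)) ∧
        -- the sample path of `u` is a càdlàg function on the torus vanishing at the tagged zero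
        Function.Periodic (fun x => u x ω) 1 ∧
        WVSobolev.IsCadlag (fun x => u x ω) ∧
        u 0 ω = 0 ∧
        -- it is a weak solution, and the only one
        WVSobolev.IsWeakSolution p κ H (WVSobolev.whiteNoise p (fun t => B t ω))
          (fun x => u x ω) ∧
        ∀ v : ℝ → ℝ,
          WVSobolev.IsWeakSolution p κ H (WVSobolev.whiteNoise p (fun t => B t ω)) v →
            v =ᵐ[p.muV] fun x => u x ω := by
  have h : WVSobolev.IsElliptic p κ H := by
    refine ⟨hκ_meas, hH_meas, hκ_bdd, ?_, hH_away⟩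
    obtain ⟨K, hK⟩ := hH_bdd
    obtain ⟨H₀, hpos, hH₀⟩ := hH_away
    exact ⟨K, fun x => abs_le.2 ⟨by linarith [hH₀ x, hK x], hK x⟩⟩
  -- Since the Green function is deterministic, this formula is measurable in `ω` for every `x`,
  -- also on the null set where the path is not càdlàg.
  let u : ℝ → Ω → ℝ := fun x ω =>
    -∫ s, WVSobolev.leftPath B (s, ω) *
      (h.green (Int.fract x) : Lp ℝ 2 p.muW) s ∂p.muW
  refine ⟨u, fun x => ?_, ?_⟩
  · refine Measurable.neg (StronglyMeasurable.measurable ?_)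
    exact StronglyMeasurable.integral_prod_left'
      ((WVSobolev.measurable_leftPath hB.measurable).mul
        ((Lp.stronglyMeasurable (h.green (Int.fract x) : Lp ℝ 2 p.muW)).comp_measurable
          measurable_fst))
  filter_upwards [hB.cadlag] with ω hω
  have hmem := WVSobolev.memLp_leftLim (p := p) hB.measurable hω
  set β : Lp ℝ 2 p.muW := hmem.toLp _
  have hβ : β =ᵐ[p.muW] Function.leftLim fun t => B t ω := hmem.coeFn_toLp
  have hu : (fun x => u x ω) = fun x =>
      WVSobolev.primW p 0 (h.resolvent (-β) : Lp ℝ 2 p.muW) (Int.fract x) := by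
    ext x
    rw [h.primW_resolvent, inner_neg_left, L2.inner_def]
    refine congrArg Neg.neg (integral_congr_ae ?_)
    filter_upwards [hβ, p.ae_muW_mem_Ioo] with s h1 h2
    rw [h1, WVSobolev.leftPath_eq hω h2]
    simp [mul_comm]
  have hae := WVSobolev.comp_fract_ae_eq (p := p)
    (WVSobolev.primW p 0 (h.resolvent (-β) : Lp ℝ 2 p.muW))
  refine ⟨fun g hg => WVSobolev.integrable_noiseIntegrand hβ hg,
    WVSobolev.memDualHD_whiteNoise hβ, fun x => by simp [u], ?_, ?_, ?_, fun v hv => ?_⟩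
  · rw [hu]
    exact (WVSobolev.isCadlag_primW 0 (WVSobolev.integrable_Lp _)).comp_fract
  · have := congrFun hu 0
    simpa using this
  · rw [hu]
    exact WVSobolev.isWeakSolution_of_hasWeakDeriv_resolvent h hβ
      ((WVSobolev.hasWeakDeriv_primW _).congr hae)
  · rw [hu]
    exact (hv.ae_eq h hβ).trans hae.symm
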